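/- **Economy.** Dates are $t=0,1,2,\dots$. Aggregate consumption is $\bar C_t=\bar C_{t-1}\varepsilon_{c,t}$ with a constant $\bar C_{-1}>0$; dividends are $D_t=\bar C_t/Y_t$; labor income is $L_t=\bar C_t-D_t$; all of $\varepsilon_{c,t},Y_t$ are positive. Let $\mathcal F_t=\sigma((\varepsilon_{c,s},Y_s):s\le t)$, $\mathcal F_{-1}$ trivial, and $\mathbb E_t=\mathbb E[\,\cdot\mid\mathcal F_t]$. The $\varepsilon_{c,t}$ are independent of $\mathcal F_{t-1}$ and identically distributed with a continuous distribution function $F$; the state $(\varepsilon_{c,t},Y_t)$ is a time-homogeneous Markov process for $(\mathcal F_t)$, and the conditional law of $Y_{t+1}$ given $\mathcal F_t$ depends on $Y_t$ only. (This includes log-normal i.i.d. $\varepsilon_{c,t}$ with positive variance and a log-normal AR(1) process $Y_t$.) **Prices.** The stock (one unit) has price $S_t=g(\varepsilon_{c,t},Y_t)D_t$ with $g$ positive and measurable, and gross return $R_{S,t+1}=(S_{t+1}+D_{t+1})/S_t$; the risk-free gross return $R_{f,t+1}$ is $\mathcal F_t$-measurable. **Agent.** Let $\beta,\theta>0$,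 $b,\gamma\ge0$, $\lambda\ge1$. Let $m(x)=x^{1-\theta}/(1-\theta)$ for $\theta\neq1$, $m=\log$ for $\theta=1$; $\mu(x)=x$ for $x\ge0$, $\mu(x)=\lambda x$ for $x<0$. An adapted plan $(C_t,\alpha_t)$ (consumption, fraction of the remaining wealth invested in the stock) generates wealth $W_{t+1}=(W_t-C_t)(\alpha_tR_{S,t+1}+(1-\alpha_t)R_{f,t+1})+L_{t+1}$, $W_0=S_0+D_0+L_0$. Given a reference plan $(C^\star,\alpha^\star)$ with wealth $W^\star$, the utility of a plan at date $t$ is $$\tilde U_t=m(C_t)+b\,\mathbb E_t\big[\mu(m(C_t)-m(\tilde C_{t-1,t}))\big]+\gamma\sum_{s\ge1}\beta^s\,\mathbb E_t\big[\mu(m(\hat C_{t,t+s})-m(\hat C_{t-1,t+s}))\big],$$ where $\tilde C_{t-1,t}$ is an independent draw from the conditional law of $C_t^\star$ given $\mathcal F_{t-1}$, $\hat C_{t-1,t+s}=\tilde C_{t-1,t}\,C^\star_{t+s}/C^\star_t$, and $\hat C_{t,t+s}=\frac{C^\star_{t+s}}{W^\star_{t+s}}\prod_{i=2}^s\frac{W^\star_{t+i}}{W^\star_{t+i-1}}\,W_{t+1}$.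 The cumulative utility is $\tilde V_t=\mathbb E_t[\sum_{s\ge t}\beta^{s-t}\tilde U_s]$. A plan is admissible from date $t$ on if it has positive consumption and wealth and all expectations and series in $\tilde V_t$ converge absolutely. **Equilibrium.** The prices form an equilibrium if the plan $C^\star_t=\bar C_t$, $\alpha^\star_t=1$ is optimal given the beliefs it induces itself, in one of the following two senses. (a) *Interior maximum*: for every $t$ it is admissible and maximizes $\tilde V_t$ a.s. over all admissible plans that agree with it before $t$; and for every $t$ all sufficiently small ($\mathcal F_t$-measurable) changes of $(C_t,\alpha_t)$, with the resulting change of $W_{t+1}$ absorbed by $C_{t+1}$ and no later change, are admissible. (b) *First-order optimality*: for every $t$ and every direction $(u,v)\in\mathbb R^2$, the derivative at $\delta=0$ of the cumulative utility $\tilde V_t$ along the change $(\bar C_t+\delta u,\,1+\delta v)$ of $(C_t,\alpha_t)$, absorbed by $C_{t+1}$ in the same way, taken scenario by scenario inside the expectations and sums, converges absolutely and is $\le0$ a.s. (Sense (b) is the one that applies when, as for log-normal growth, no trade of positive size is affordable in all scenarios.) **Theorem.** Write $A(x)=1+bF(x)+b\lambda(1-F(x))$, $G(x)=F(x)+\lambda(1-F(x))$.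 Assume that $\varepsilon_{c,t+1}^{1-\theta}$ is integrable and $\beta\,\mathbb E[\varepsilon_{c,t+1}^{1-\theta}]<1$, and put $\kappa=1-\beta\,\mathbb E[\varepsilon_{c,t+1}^{1-\theta}]$. Then in every equilibrium there is a positive measurable function $h$ such that, for all $t$, almost surely, all the expectations below are finite and $$R_{f,t+1}=A(\varepsilon_{c,t})\left(\gamma G(\varepsilon_{c,t})\,\beta\,\mathbb E_t\!\left[\varepsilon_{c,t+1}^{-\theta}Y_{t+1}\frac{A(\varepsilon_{c,t+1})}{Y_{t+1}A(\varepsilon_{c,t+1})\kappa+h(\varepsilon_{c,t+1},Y_{t+1})}\right]+\beta\,\mathbb E\!\left[\varepsilon_{c,t+1}^{-\theta}A(\varepsilon_{c,t+1})\right]\right)^{-1},$$ $$\frac{S_t}{D_t}=\frac{h(\varepsilon_{c,t},Y_t)}{A(\varepsilon_{c,t})\,\kappa},$$ where $h$ solves the integral equation $$h(\varepsilon_{c,t},Y_t)=\gamma G(\varepsilon_{c,t})\,\beta\,\mathbb E_t\!\left[\varepsilon_{c,t+1}^{1-\theta}Y_t\frac{A(\varepsilon_{c,t+1})\kappa+h(\varepsilon_{c,t+1},Y_{t+1})}{Y_{t+1}A(\varepsilon_{c,t+1})\kappa+h(\varepsilon_{c,t+1},Y_{t+1})}\right]+\beta\,\mathbb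 E_t\!\left[\varepsilon_{c,t+1}^{1-\theta}\frac{Y_t}{Y_{t+1}}\big(h(\varepsilon_{c,t+1},Y_{t+1})+A(\varepsilon_{c,t+1})\kappa\big)\right],$$ and $$R_{S,t+1}=\varepsilon_{c,t+1}\frac{Y_t}{Y_{t+1}}\cdot\frac{A(\varepsilon_{c,t})}{h(\varepsilon_{c,t},Y_t)}\left(\frac{h(\varepsilon_{c,t+1},Y_{t+1})}{A(\varepsilon_{c,t+1})}+\kappa\right).$$ By the Markov property the conditional expectations $\mathbb E_t$ are functions of the state $(\varepsilon_{c,t},Y_t)$. -/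

import Mathlib

open MeasureTheory ProbabilityTheory

noncomputable section

namespace GainLoss

/-- The information available strictly before date `t`: the σ-algebra generated by the growth rates
`ε s` and the consumption-dividend ratios `Y s` with `s < t` (equivalently, by aggregate consumption
and dividends up to date `t - 1`). The information at date `t` is `pastInfo ε Y (t + 1)`;
before date `0` nothing is known. -/
@[reducible] def pastInfo {Ω : Type*} (ε Y : ℕ → Ω → ℝ) (t : ℕ) : MeasurableSpace Ω :=
  ⨆ (s : ℕ) (_ : s < t), MeasurableSpace.comap (fun ω => (ε s ω, Y s ω)) inferInstance

/-- The exogenous part of the economy, at dates `0, 1, 2, …`: consumption growth rates `ε` that are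
i.i.d. with an atomless law `ν`, and a consumption-dividend ratio `Y` that is a Markov chain. Given
the information at date `t`, the pair `(ε (t+1), Y (t+1))` has law `Q (ε t, Y t)`. The first marginal
of `Q` is always `ν` (so `ε (t+1)` is independent of the information at date `t`), its second
marginal depends on the current ratio only. Independence of the two coordinates is not required. -/
structure Economy {Ω : Type*} [MeasurableSpace Ω] [StandardBorelSpace Ω]
    (P : Measure Ω) [IsProbabilityMeasure P] where
  /-- aggregate consumption at date `-1` -/
  c₀ : ℝ
  c₀_pos : 0 < c₀
  /-- growth rate of aggregate consumption from date `t - 1` to date `t` -/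
  ε : ℕ → Ω → ℝ
  /-- ratio of aggregate consumption to dividends at date `t` -/
  Y : ℕ → Ω → ℝ
  measurable_ε : ∀ t, Measurable (ε t)
  measurable_Y : ∀ t, Measurable (Y t)
  ε_pos : ∀ t ω, 0 < ε t ω
  Y_pos : ∀ t ω, 0 < Y t ω
  /-- law of consumption growth -/
  ν : Measure ℝ
  prob_ν : IsProbabilityMeasure ν
  noAtoms_ν : NullSingletonClass ν
  /-- transition law of the state -/
  Q : Kernel (ℝ × ℝ) (ℝ × ℝ)
  markov_Q : IsMarkovKernel Q
  Q_fst : ∀ x, (Q x).fst = ν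
  Q_snd : ∀ e e' y, (Q (e, y)).snd = (Q (e', y)).snd
  law_init : P.map (ε 0) = ν
  law_step : ∀ t, ∀ᵐ ω ∂P,
    (condExpKernel P (pastInfo ε Y (t + 1)) ω).map (fun ω' => (ε (t + 1) ω', Y (t + 1) ω'))
      = Q (ε t ω, Y t ω)

/-- Preference parameters: discount factor `β`, relative risk aversion `θ`, weight `b` of
contemporaneous and weight `γ` of prospective gain-loss utility, degree of loss aversion `lam`. -/
structure Preferences where
  β : ℝ
  θ : ℝ
  b : ℝ
  γ : ℝ
  lam : ℝ
  β_pos : 0 < β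
  θ_pos : 0 < θ
  b_nonneg : 0 ≤ b
  γ_nonneg : 0 ≤ γ
  one_le_lam : 1 ≤ lam

namespace Preferences

/-- Power utility of consumption (logarithmic for `θ = 1`); used at positive arguments only. -/
def m (U : Preferences) (x : ℝ) : ℝ :=
  if U.θ = 1 then Real.log x else x ^ (1 - U.θ) / (1 - U.θ)

/-- Piecewise linear gain-loss utility. -/
def gl (U : Preferences) (x : ℝ) : ℝ :=
  if 0 ≤ x then x else U.lam * x

end Preferences

/-- A consumption-investment plan: consumption, and the fraction of post-consumption wealth that is
invested in the stock. -/
structure Plan (Ω : Type*) where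
  C : ℕ → Ω → ℝ
  α : ℕ → Ω → ℝ

/-- The integrands of the instantaneous utility: `now t ω ω'` is the utility at date `t` from current
consumption, `ahead t i ω ω'` the (discounted and weighted) utility at date `t` from the revision of
beliefs about consumption at date `t + i + 1`. Here `ω` is the true scenario, and `ω'` the
independent scenario in which the reference point formed at date `t - 1` is drawn. -/
structure Felicity (Ω : Type*) where
  now : ℕ → Ω → Ω → ℝ
  ahead : ℕ → ℕ → Ω → Ω → ℝ

section Model

variable {Ω : Type*} [MeasurableSpace Ω] [StandardBorelSpace Ω]
  {P : Measure Ω} [IsProbabilityMeasure P]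

namespace Economy

/-- Information at date `t`. -/
@[reducible] def info (E : Economy P) (t : ℕ) : MeasurableSpace Ω := pastInfo E.ε E.Y (t + 1)

/-- Regular conditional law of the scenario given the information at date `t`. -/
def law (E : Economy P) (t : ℕ) (ω : Ω) : Measure Ω := condExpKernel P (E.info t) ω

/-- Regular conditional law of the scenario given the information at date `t - 1`. -/
def lawBefore (E : Economy P) (t : ℕ) (ω : Ω) : Measure Ω :=
  condExpKernel P (pastInfo E.ε E.Y t) ω

/-- Aggregate consumption. -/
def C (E : Economy P) (t : ℕ) (ω : Ω) : ℝ := E.c₀ * ∏ s ∈ Finset.range (t + 1), E.ε s ω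

/-- Dividends. -/
def D (E : Economy P) (t : ℕ) (ω : Ω) : ℝ := E.C t ω / E.Y t ω

/-- Labor income. -/
def L (E : Economy P) (t : ℕ) (ω : Ω) : ℝ := E.C t ω - E.D t ω

/-- Distribution function of consumption growth. -/
def F (E : Economy P) (x : ℝ) : ℝ := cdf E.ν x

/-- Utility at date `t` of the integrands `Φ`: the expectation at date `t`, over the true scenario
(drawn from the law given the information at `t`) and the independent reference scenario (drawn from
the law given the information at `t - 1`). -/
def utility (E : Economy P) (Φ : Felicity Ω) (t : ℕ) (ω : Ω) : ℝ :=
  (∫ z, Φ.now t z.1 z.2 ∂((E.law t ω).prod (E.lawBefore t ω)))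
    + ∑' i, ∫ z, Φ.ahead t i z.1 z.2 ∂((E.law t ω).prod (E.lawBefore t ω))

/-- Cumulative discounted utility from date `t` on, in expectation at date `t`. -/
def value (E : Economy P) (β : ℝ) (Φ : Felicity Ω) (t : ℕ) (ω : Ω) : ℝ :=
  ∫ ω', ∑' n, β ^ n * E.utility Φ (t + n) ω' ∂(E.law t ω)

/-- All expectations and series that enter the cumulative utility from date `t` on converge
absolutely. -/
def Converges (E : Economy P) (β : ℝ) (Φ : Felicity Ω) (t : ℕ) : Prop :=
  (∀ s, t ≤ s → ∀ᵐ ω ∂P,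
    Integrable (fun z : Ω × Ω => Φ.now s z.1 z.2) ((E.law s ω).prod (E.lawBefore s ω)) ∧
    (∀ i, Integrable (fun z : Ω × Ω => Φ.ahead s i z.1 z.2)
      ((E.law s ω).prod (E.lawBefore s ω))) ∧
    Summable fun i => ∫ z, |Φ.ahead s i z.1 z.2| ∂((E.law s ω).prod (E.lawBefore s ω))) ∧
  ∀ᵐ ω ∂P, (∀ n, Integrable (E.utility Φ (t + n)) (E.law t ω)) ∧
    Summable fun n => β ^ n * ∫ ω', |E.utility Φ (t + n) ω'| ∂(E.law t ω)

end Economy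

/-- Asset prices: the price-dividend ratio is a positive function `g` of the state `(ε t, Y t)`; the
risk-free gross return `Rf t` over the period from `t` to `t + 1` is known at date `t`. -/
structure Prices (E : Economy P) where
  g : ℝ × ℝ → ℝ
  measurable_g : Measurable g
  g_pos : ∀ e y, 0 < e → 0 < y → 0 < g (e, y)
  Rf : ℕ → Ω → ℝ
  adapted_Rf : ∀ t, Measurable[E.info t] (Rf t)

namespace Prices

variable {E : Economy P}

/-- Stock price. -/
def S (p : Prices E) (t : ℕ) (ω : Ω) : ℝ := p.g (E.ε t ω, E.Y t ω) * E.D t ω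

/-- Gross return of the stock over the period from `t` to `t + 1`. -/
def RS (p : Prices E) (t : ℕ) (ω : Ω) : ℝ := (p.S (t + 1) ω + E.D (t + 1) ω) / p.S t ω

/-- Wealth at date `t + 1` after starting date `t` with wealth `w`, consuming `c` and investing the
fraction `a` of the rest in the stock. -/
def nextWealth (p : Prices E) (t : ℕ) (w c a : ℝ) (ω : Ω) : ℝ :=
  (w - c) * (a * p.RS t ω + (1 - a) * p.Rf t ω) + E.L (t + 1) ω

/-- Wealth before consumption along a plan. The agent starts with the one unit of the stock, its
dividend and her labor income. -/
def wealth (p : Prices E) (X : Plan Ω) : ℕ → Ω → ℝ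
  | 0, ω => p.S 0 ω + E.D 0 ω + E.L 0 ω
  | t + 1, ω => p.nextWealth t (p.wealth X t ω) (X.C t ω) (X.α t ω) ω

/-- `Ĉ_{t,t+s}` for `s ≥ 1`: consumption at date `t + s` as expected at date `t` when following the
plan `X` now. Future selves are taken to consume the fraction `C⋆/W⋆` of wealth, and wealth to grow
after date `t + 1` by the factors `W⋆_{t+i}/W⋆_{t+i-1}`, which are those of the plan `star`. -/
def expected (p : Prices E) (star X : Plan Ω) (t s : ℕ) (ω : Ω) : ℝ :=
  star.C (t + s) ω / p.wealth star (t + s) ω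
    * (∏ i ∈ Finset.Icc 2 s, p.wealth star (t + i) ω / p.wealth star (t + i - 1) ω)
    * p.wealth X (t + 1) ω

/-- Utility of the plan `X` when the beliefs are those induced by the plan `star`. The reference
point `C̃_{t-1,t}` for current consumption is `star.C t ω'`, where `ω'` is drawn independently from
the law given the information at date `t - 1`. The reference point `Ĉ_{t-1,t+s}` for consumption at
date `t + s` is the same draw times `star.C (t + s) / star.C t`. -/
def felicity (p : Prices E) (U : Preferences) (star X : Plan Ω) : Felicity Ω where
  now t ω ω' := U.m (X.C t ω) + U.b * U.gl (U.m (X.C t ω) - U.m (star.C t ω'))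
  ahead t i ω ω' := U.γ * U.β ^ (i + 1) *
    U.gl (U.m (p.expected star X t (i + 1) ω)
      - U.m (star.C t ω' * (star.C (t + i + 1) ω / star.C t ω)))

/-- Admissible plans from date `t` on: nonanticipating, with positive consumption and wealth, and
with a well-defined finite cumulative utility. -/
def Admissible (p : Prices E) (U : Preferences) (star X : Plan Ω) (t : ℕ) : Prop :=
  (∀ s, Measurable[E.info s] (X.C s) ∧ Measurable[E.info s] (X.α s)) ∧
  (∀ s, t ≤ s → ∀ᵐ ω ∂P, 0 < X.C s ω ∧ 0 < p.wealth X s ω) ∧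
  E.Converges U.β (p.felicity U star X) t

/-- The plan `star` maximizes the cumulative utility from every date on, given the beliefs that it
induces itself. -/
def IsMaximal (p : Prices E) (U : Preferences) (star : Plan Ω) : Prop :=
  ∀ t, p.Admissible U star star t ∧
    ∀ X : Plan Ω, (∀ s, s < t → X.C s = star.C s ∧ X.α s = star.α s) →
      p.Admissible U star X t →
        ∀ᵐ ω ∂P, E.value U.β (p.felicity U star X) t ω
          ≤ E.value U.β (p.felicity U star star) t ω

/-- The plan that departs from `star` at date `t`, by consuming `c` and investing the fraction `a` in
the stock, lets consumption at date `t + 1` absorb the change of wealth, and then returns to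
`star`. -/
def detour (p : Prices E) (star : Plan Ω) (t : ℕ) (c a : Ω → ℝ) : Plan Ω where
  C s ω := if s = t then c ω
    else if s = t + 1 then
      star.C (t + 1) ω
        + (p.nextWealth t (p.wealth star t ω) (c ω) (a ω) ω - p.wealth star (t + 1) ω)
    else star.C s ω
  α s ω := if s = t then a ω else star.α s ω

/-- `star` is an interior plan: at every date, sufficiently small changes of current consumption and
of the current portfolio are admissible. -/
def IsInterior (p : Prices E) (U : Preferences) (star : Plan Ω) : Prop :=
  ∀ t, ∃ η : Ω → ℝ, Measurable[E.info t] η ∧ (∀ ω, 0 < η ω) ∧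
    ∀ c a : Ω → ℝ, Measurable[E.info t] c → Measurable[E.info t] a →
      (∀ ω, |c ω - star.C t ω| ≤ η ω) → (∀ ω, |a ω - star.α t ω| ≤ η ω) →
        p.Admissible U star (p.detour star t c a) t

/-- The scenario-wise derivative at `δ = 0` of the utility along a family `X δ` of plans. -/
def marginal (p : Prices E) (U : Preferences) (star : Plan Ω) (X : ℝ → Plan Ω) : Felicity Ω where
  now t ω ω' := deriv (fun δ => (p.felicity U star (X δ)).now t ω ω') 0
  ahead t i ω ω' := deriv (fun δ => (p.felicity U star (X δ)).ahead t i ω ω') 0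

/-- `star` is optimal to first order: at every date, no infinitesimal change of current consumption
and of the current portfolio has a positive expected marginal utility. This is the meaning of
optimality when no trade of positive size, however small, is affordable in all scenarios (as
with log-normal growth), so that an optimum cannot be interior. -/
def IsMarginallyOptimal (p : Prices E) (U : Preferences) (star : Plan Ω) : Prop :=
  ∀ (t : ℕ) (u v : ℝ),
    E.Converges U.β (p.marginal U star fun δ =>
      p.detour star t (fun ω => star.C t ω + δ * u) (fun ω => star.α t ω + δ * v)) t ∧
    ∀ᵐ ω ∂P, E.value U.β (p.marginal U star fun δ =>
      p.detour star t (fun ω => star.C t ω + δ * u) (fun ω => star.α t ω + δ * v)) t ω ≤ 0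

/-- Equilibrium: under the beliefs that it induces, the optimal plan consumes aggregate consumption
and invests exactly in the stock. Optimal means: an interior maximum, or optimal to first order. -/
def IsEquilibrium (p : Prices E) (U : Preferences) : Prop :=
  ∃ star : Plan Ω,
    ((p.IsMaximal U star ∧ p.IsInterior U star) ∨ p.IsMarginallyOptimal U star) ∧
    (∀ t ω, star.C t ω = E.C t ω) ∧ (∀ t ω, star.α t ω = 1)

end Prices

/-- `1 + b F(x) + b λ (1 - F(x))` -/
def A (E : Economy P) (U : Preferences) (x : ℝ) : ℝ :=
  1 + U.b * E.F x + U.b * U.lam * (1 - E.F x)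

/-- `F(x) + λ (1 - F(x))` -/
def G (E : Economy P) (U : Preferences) (x : ℝ) : ℝ :=
  E.F x + U.lam * (1 - E.F x)

/-- `1 - β 𝔼[ε ^ (1 - θ)]` -/
def κ (E : Economy P) (U : Preferences) : ℝ :=
  1 - U.β * ∫ x, x ^ (1 - U.θ) ∂E.ν

end Model

end GainLoss

end

open GainLoss

/-! The pricing formulas are the two Euler equations of the market plan, for the stock and for the
risk-free asset, written in terms of the state. A trade of size `δ` at date `t` in the direction
`(u, v)` changes wealth at `t + 1` by `δ * gain` to first order. Consumption at `t + 1` absorbs the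
change, so later wealth is unaffected. Only three pieces of utility react: consumption utility at
`t`, prospective gain-loss utility at `t`, and consumption utility at `t + 1`.

Gain-loss utility multiplies marginal utility by 1 after a gain and by λ after a loss. The reference
draw and actual consumption share the same past consumption, so gain or loss is decided by comparing
two growth rates, and ties are null because `ν` has no atoms. Averaging over the draw turns the
multiplier into `G`, and total marginal utility into `A = 1 + b G` (`integral_slope`,
`ae_integral_one_add_slope`). In prospective utility, expected consumption is `C (t + s)` times
relative wealth at `t + 1` (`expected_market`), and its reference point carries the same growth
factor. Hence every horizon has the same multiplier, and the horizons sum to a geometric series of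
ratio `β 𝔼[ε ^ (1 - θ)]`, the origin of `β / κ` (`ae_utility_tradeSlope_self`).

The analytic issue is differentiation inside expectations and series. First-order optimality assumes
it. For an interior maximum it follows from concavity: if only consumption or only the portfolio is
changed, wealth is affine in `δ`, so the difference quotients lie between the increments over `[0,
1]` and `[-1, 0]`. These are integrable because the trades with `δ = 1` and `δ = -1` are admissible,
and dominated convergence applies (`HasConcaveSlope.integral`). Both notions of equilibrium thus
yield `NotProfitable`, and opposite trades turn the inequalities into the equations `ae_euler`.

With `h = g A κ` the stock equation becomes the integral equation. The other one is linear in the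
risk-free return; solving it requires first splitting the integral of the excess return
(`riskFree_of_euler`). -/

noncomputable section

namespace GainLoss

open Filter
open scoped Topology

/-! ### Regular conditional laws: known variables, tower property, independence. -/

section Kernels

/-- A countable π-system that generates the σ-algebra of a countably generated space. -/
theorem exists_countable_piSystem (α : Type*) [mα : MeasurableSpace α]
    [MeasurableSpace.CountablyGenerated α] :
    ∃ S : Set (Set α), S.Countable ∧ IsPiSystem S ∧ mα = MeasurableSpace.generateFrom S := by
  set T := MeasurableSpace.countableGeneratingSet α with hT
  have hTc : T.Countable := MeasurableSpace.countable_countableGeneratingSet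
  refine ⟨(fun F => ⋂₀ F) '' {F : Set (Set α) | F.Finite ∧ F ⊆ T},
    (Set.countable_ofPred_finite_subset hTc).image _, ?_, ?_⟩
  · rintro _ ⟨F, hF, rfl⟩ _ ⟨F', hF', rfl⟩ -
    exact ⟨F ∪ F', ⟨hF.1.union hF'.1, Set.union_subset hF.2 hF'.2⟩, Set.sInter_union F F'⟩
  · apply le_antisymm
    · rw [← MeasurableSpace.generateFrom_countableGeneratingSet (α := α)]
      refine MeasurableSpace.generateFrom_mono fun s hs => ?_
      exact ⟨{s}, ⟨Set.finite_singleton s, Set.singleton_subset_iff.2 hs⟩, Set.sInter_singleton s⟩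
    · refine MeasurableSpace.generateFrom_le ?_
      rintro _ ⟨F, hF, rfl⟩
      exact MeasurableSet.sInter hF.1.countable fun s hs =>
        MeasurableSpace.measurableSet_countableGeneratingSet (hF.2 hs)

/-- A probability measure is determined by a countable generating π-system, so only countably many
exceptional null sets have to be joined. -/
theorem ae_eq_of_forall_measurableSet {α Ω : Type*} [MeasurableSpace α]
    [MeasurableSpace.CountablyGenerated α] {mΩ : MeasurableSpace Ω} {P : Measure Ω}
    {κ η : Ω → Measure α} [∀ ω, IsProbabilityMeasure (κ ω)] [∀ ω, IsProbabilityMeasure (η ω)]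
    (h : ∀ s, MeasurableSet s → ∀ᵐ ω ∂P, κ ω s = η ω s) : ∀ᵐ ω ∂P, κ ω = η ω := by
  obtain ⟨S, hSc, hSpi, hS⟩ := exists_countable_piSystem α
  have : ∀ᵐ ω ∂P, ∀ s ∈ S, κ ω s = η ω s := by
    rw [ae_ball_iff hSc]
    intro s hs
    exact h s (hS ▸ MeasurableSpace.measurableSet_generateFrom hs)
  filter_upwards [this] with ω hω
  exact ext_of_generate_finite S hS hSpi hω (by simp)

variable {Ω : Type*} {m m₁ m₂ : MeasurableSpace Ω} [mΩ : MeasurableSpace Ω] [StandardBorelSpace Ω]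
  {P : Measure Ω} [IsProbabilityMeasure P]

theorem measurable_condExpKernel_measure (hm : m ≤ mΩ) :
    Measurable fun ω => condExpKernel P m ω :=
  (condExpKernel P m).measurable.mono hm le_rfl

/-- `P` is the mixture of its conditional laws, so a `P`-null set is null for almost all of them. -/
theorem ae_ae_condExpKernel (hm : m ≤ mΩ) {p : Ω → Prop} (h : ∀ᵐ ω ∂P, p ω) :
    ∀ᵐ ω ∂P, ∀ᵐ ω' ∂(condExpKernel P m ω), p ω' := by
  have h' : ∀ᵐ ω ∂(condExpKernel P m ∘ₘ P.trim hm), p ω := by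
    rwa [condExpKernel_comp_trim hm]
  exact ae_of_ae_trim hm (Measure.ae_ae_of_ae_comp h')

theorem ae_eq_condExpKernel (hm : m ≤ mΩ) {β : Type*} [MeasurableSpace β] [MeasurableEq β]
    {f : Ω → β} (hf : Measurable[m] f) :
    ∀ᵐ ω ∂P, ∀ᵐ ω' ∂(condExpKernel P m ω), f ω' = f ω := by
  -- The composition-product is the image of `P` under the diagonal. The first coordinate carries
  -- the σ-algebra `m`, hence the explicit instances below.
  have h1 : ∀ᵐ z ∂((P.trim hm) ⊗ₘ condExpKernel P m), f z.2 = f z.1 := by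
    rw [compProd_trim_condExpKernel hm]
    have hd : @Measurable Ω (Ω × Ω) mΩ (m.prod mΩ) Function.diag := by
      exact @Measurable.prodMk Ω mΩ Ω Ω m mΩ id id (measurable_id'' hm) (@measurable_id Ω mΩ)
    rw [@ae_map_iff Ω (Ω × Ω) mΩ (m.prod mΩ) P _ (@Measurable.aemeasurable _ _ mΩ (m.prod mΩ) _ P hd)]
    · exact ae_of_all _ fun _ => rfl
    · have h2 : @Measurable _ _ (m.prod mΩ) _ fun z : Ω × Ω => f z.2 :=
        (hf.mono hm le_rfl).comp (@measurable_snd Ω Ω m mΩ)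
      have h3 : @Measurable _ _ (m.prod mΩ) _ fun z : Ω × Ω => f z.1 :=
        hf.comp (@measurable_fst Ω Ω m mΩ)
      exact @measurableSet_eq_fun _ _ (m.prod mΩ) _ _ _ _ h2 h3
  exact ae_of_ae_trim hm (Measure.ae_ae_of_ae_compProd h1)

/-- Given the information `m₂`, the conditional law given coarser information is known. -/
theorem ae_condExpKernel_eq (h₁ : m₁ ≤ m₂) (h₂ : m₂ ≤ mΩ) :
    ∀ᵐ ω ∂P, ∀ᵐ ω' ∂(condExpKernel P m₂ ω), condExpKernel P m₁ ω' = condExpKernel P m₁ ω := by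
  obtain ⟨S, hSc, hSpi, hS⟩ := exists_countable_piSystem Ω
  have : ∀ᵐ ω ∂P, ∀ s ∈ S, ∀ᵐ ω' ∂(condExpKernel P m₂ ω),
      condExpKernel P m₁ ω' s = condExpKernel P m₁ ω s := by
    rw [ae_ball_iff hSc]
    intro s hs
    refine ae_eq_condExpKernel h₂ (f := fun ω => condExpKernel P m₁ ω s) ?_
    exact (measurable_condExpKernel
      (hS ▸ MeasurableSpace.measurableSet_generateFrom hs)).mono h₁ le_rfl
  filter_upwards [this] with ω hω
  rw [← ae_ball_iff hSc] at hω
  filter_upwards [hω] with ω' hω'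
  exact ext_of_generate_finite S hS hSpi hω' (by simp)

/-- The tower property of regular conditional laws. -/
theorem condExpKernel_tower (h₁ : m₁ ≤ m₂) (h₂ : m₂ ≤ mΩ) :
    ∀ᵐ ω ∂P, (condExpKernel P m₁ ω).bind (fun ω' => condExpKernel P m₂ ω')
      = condExpKernel P m₁ ω := by
  have hprob : ∀ ω, IsProbabilityMeasure
      ((condExpKernel P m₁ ω).bind fun ω' => condExpKernel P m₂ ω') := fun ω =>
    isProbabilityMeasure_bind (measurable_condExpKernel_measure h₂).aemeasurable
      (ae_of_all _ fun _ => inferInstance)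
  have hprob' : ∀ ω, IsProbabilityMeasure (condExpKernel P m₁ ω) := fun ω => inferInstance
  refine ae_eq_of_forall_measurableSet fun s hs => ?_
  have h12 := h₁.trans h₂
  have hint : Integrable (fun ω => (condExpKernel P m₂ ω).real s) P :=
    integrable_toReal_condExpKernel hs
  have e1 := condExp_ae_eq_integral_condExpKernel h12 hint
  have e2 : P[(fun ω => (condExpKernel P m₂ ω).real s) | m₁] =ᵐ[P] P[P⟦s | m₂⟧ | m₁] :=
    condExp_congr_ae (condExpKernel_ae_eq_condExp h₂ hs)
  have e3 : P[P⟦s | m₂⟧ | m₁] =ᵐ[P] P⟦s | m₁⟧ := condExp_condExp_of_le h₁ h₂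
  have e4 := condExpKernel_ae_eq_condExp (μ := P) h12 hs
  filter_upwards [e1, e2, e3, e4] with ω a1 a2 a3 a4
  have : ((condExpKernel P m₁ ω).bind fun ω' => condExpKernel P m₂ ω').real s
      = (condExpKernel P m₁ ω).real s := by
    rw [a4, ← a3, ← a2, a1, measureReal_def,
      Measure.bind_apply hs (measurable_condExpKernel_measure h₂).aemeasurable]
    simp only [measureReal_def]
    rw [integral_toReal]
    · exact ((measurable_condExpKernel hs).mono h₂ le_rfl).aemeasurable
    · exact ae_of_all _ fun _ => measure_lt_top _ _
  exact (measureReal_eq_measureReal_iff).1 this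

/-- If the law of `X` given the information `m₂` is a constant `ν`, then `X` is independent of
`m₂`-measurable variables also under the conditional law given coarser information. -/
theorem indepFun_condExpKernel (h₁ : m₁ ≤ m₂) (h₂ : m₂ ≤ mΩ) {f X : Ω → ℝ} {ν : Measure ℝ}
    (hf : Measurable[m₂] f) (hX : Measurable X)
    (hν : ∀ᵐ ω ∂P, (condExpKernel P m₂ ω).map X = ν) :
    ∀ᵐ ω ∂P, IndepFun f X (condExpKernel P m₁ ω) ∧ (condExpKernel P m₁ ω).map X = ν := by
  have h12 := h₁.trans h₂
  filter_upwards [condExpKernel_tower (P := P) h₁ h₂, ae_ae_condExpKernel h12 hν,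
    ae_ae_condExpKernel h12 (ae_eq_condExpKernel (P := P) h₂ hf)] with ω hω hνω hfω
  -- Conditioning further on `m₂` freezes `f`, so the inner probability is `ν B` if the value of `f`
  -- lies in `A`, and zero otherwise.
  have key : ∀ A B : Set ℝ, MeasurableSet A → MeasurableSet B →
      condExpKernel P m₁ ω (f ⁻¹' A ∩ X ⁻¹' B) = condExpKernel P m₁ ω (f ⁻¹' A) * ν B := by
    intro A B hA hB
    have hfA : MeasurableSet (f ⁻¹' A) := (hf.mono h₂ le_rfl) hA
    conv_lhs => rw [← hω, Measure.bind_apply (hfA.inter (hX hB))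
      (measurable_condExpKernel_measure h₂).aemeasurable]
    have : ∀ᵐ ω' ∂(condExpKernel P m₁ ω), condExpKernel P m₂ ω' (f ⁻¹' A ∩ X ⁻¹' B)
        = (f ⁻¹' A).indicator (fun _ => ν B) ω' := by
      filter_upwards [hνω, hfω] with ω' h1 h2
      rw [← h1, Measure.map_apply hX hB]
      by_cases hA' : f ω' ∈ A
      · rw [Set.indicator_of_mem (by exact hA')]
        refine measure_congr ?_
        filter_upwards [h2] with x hx
        refine propext ⟨fun h => h.2, fun h => ⟨?_, h⟩⟩
        change f x ∈ A
        rwa [hx]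
      · rw [Set.indicator_of_notMem (by exact hA')]
        rw [← nonpos_iff_eq_zero, ← measure_empty (μ := condExpKernel P m₂ ω')]
        refine (measure_mono_ae ?_)
        filter_upwards [h2] with x hx hx'
        exact hA' (hx ▸ hx'.1)
    rw [lintegral_congr_ae this, lintegral_indicator hfA, setLIntegral_const, mul_comm]
  have hXν : (condExpKernel P m₁ ω).map X = ν := by
    ext B hB
    rw [Measure.map_apply hX hB]
    simpa using key Set.univ B MeasurableSet.univ hB
  refine ⟨?_, hXν⟩
  rw [indepFun_iff_measure_inter_preimage_eq_mul]
  intro A B hA hB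
  rw [key A B hA hB, ← hXν, Measure.map_apply hX hB]

end Kernels

/-! ### Concavity and derivatives of consumption and gain-loss utility. -/

namespace Preferences

variable (U : Preferences)

theorem hasDerivAt_m {x : ℝ} (hx : 0 < x) : HasDerivAt U.m (x ^ (-U.θ)) x := by
  by_cases h : U.θ = 1
  · have : U.m = Real.log := by funext y; simp [m, h]
    rw [this, h, Real.rpow_neg_one]
    exact Real.hasDerivAt_log hx.ne'
  · have : U.m = fun y => y ^ (1 - U.θ) / (1 - U.θ) := by funext y; simp [m, h]
    rw [this]
    have h1 : 1 - U.θ ≠ 0 := fun h' => h (by linarith)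
    have := (Real.hasDerivAt_rpow_const (x := x) (p := 1 - U.θ) (Or.inl hx.ne')).div_const (1 - U.θ)
    have e : x ^ (-U.θ) = (1 - U.θ) * x ^ (1 - U.θ - 1) / (1 - U.θ) := by
      rw [mul_div_cancel_left₀ _ h1]
      congr 1
      ring
    rwa [e]

theorem continuousOn_m : ContinuousOn U.m (Set.Ioi 0) := fun _ hx =>
  (U.hasDerivAt_m hx).continuousAt.continuousWithinAt

theorem strictMonoOn_m : StrictMonoOn U.m (Set.Ioi 0) := by
  refine strictMonoOn_of_deriv_pos (convex_Ioi 0) U.continuousOn_m fun x hx => ?_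
  rw [interior_Ioi] at hx
  rw [(U.hasDerivAt_m hx).deriv]
  exact Real.rpow_pos_of_pos hx _

theorem concaveOn_m : ConcaveOn ℝ (Set.Ioi 0) U.m := by
  refine AntitoneOn.concaveOn_of_deriv (convex_Ioi 0) U.continuousOn_m ?_ ?_
  · rw [interior_Ioi]
    exact fun x hx => (U.hasDerivAt_m hx).differentiableAt.differentiableWithinAt
  · rw [interior_Ioi]
    intro x hx y hy hxy
    rw [(U.hasDerivAt_m hx).deriv, (U.hasDerivAt_m hy).deriv]
    exact Real.rpow_le_rpow_of_nonpos hx hxy (by linarith [U.θ_pos])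

theorem gl_eq_min (x : ℝ) : U.gl x = min x (U.lam * x) := by
  have := U.one_le_lam
  unfold gl
  split_ifs with h
  · rw [min_eq_left]; nlinarith
  · rw [min_eq_right]; nlinarith

/-- Because `1 ≤ lam`, gain-loss utility is the minimum of two increasing linear functions; composed
with a concave function it remains a minimum of concave functions. -/
theorem concaveOn_gl_m_sub (q : ℝ) :
    ConcaveOn ℝ (Set.Ioi 0) fun x => U.gl (U.m x - U.m q) := by
  have h1 : ConcaveOn ℝ (Set.Ioi 0) fun x => U.m x - U.m q :=
    U.concaveOn_m.sub (convexOn_const _ (convex_Ioi 0))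
  have h2 := h1.inf (h1.smul (c := U.lam) (by linarith [U.one_le_lam]))
  refine h2.congr fun x _ => ?_
  simp [gl_eq_min]

/-- Slope of gain-loss utility of consuming `c` when the reference point is `q`. -/
def slope (q c : ℝ) : ℝ := if q < c then 1 else U.lam

theorem hasDerivAt_gl_m_sub {q c : ℝ} (hq : 0 < q) (hc : 0 < c) (hqc : q ≠ c) :
    HasDerivAt (fun x => U.gl (U.m x - U.m q)) (U.slope q c * c ^ (-U.θ)) c := by
  have hm := (U.hasDerivAt_m hc).sub_const (U.m q)
  unfold slope
  split_ifs with h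
  · rw [one_mul]
    refine hm.congr_of_eventuallyEq ?_
    filter_upwards [lt_mem_nhds h] with x hx
    have := U.strictMonoOn_m hq (hq.trans hx) hx
    rw [gl, if_pos (by linarith)]
  · have h' : c < q := lt_of_le_of_ne (not_lt.1 h) hqc.symm
    refine (hm.const_mul U.lam).congr_of_eventuallyEq ?_
    filter_upwards [gt_mem_nhds h', lt_mem_nhds hc] with x hx hx0
    have := U.strictMonoOn_m hx0 hq hx
    rw [gl, if_neg (by linarith)]

/-- Utility of consuming `x` when the reference point is `q`. -/
def total (q x : ℝ) : ℝ := U.m x + U.b * U.gl (U.m x - U.m q)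

theorem concaveOn_total (q : ℝ) : ConcaveOn ℝ (Set.Ioi 0) (U.total q) :=
  U.concaveOn_m.add ((U.concaveOn_gl_m_sub q).smul U.b_nonneg)

theorem hasDerivAt_total {q c : ℝ} (hq : 0 < q) (hc : 0 < c) (hqc : q ≠ c) :
    HasDerivAt (U.total q) (c ^ (-U.θ) * (1 + U.b * U.slope q c)) c := by
  have e : c ^ (-U.θ) * (1 + U.b * U.slope q c)
      = c ^ (-U.θ) + U.b * (U.slope q c * c ^ (-U.θ)) := by ring
  rw [e]
  exact (U.hasDerivAt_m hc).add ((U.hasDerivAt_gl_m_sub hq hc hqc).const_mul U.b)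

theorem slope_mul {q c a : ℝ} (ha : 0 < a) : U.slope (q * a) (c * a) = U.slope q c := by
  simp [slope, mul_lt_mul_iff_left₀ ha]

end Preferences

/-! ### Slopes of concave functions under integrals and series. -/

/-- The step sizes of the difference quotients in `HasConcaveSlope`. -/
def steps : Set ℝ := insert (-1) (insert 0 (Set.range fun n : ℕ => 1 / ((n : ℝ) + 1)))

theorem countable_steps : steps.Countable := ((Set.countable_range _).insert _).insert _

theorem neg_one_mem_steps : (-1 : ℝ) ∈ steps := Set.mem_insert _ _

theorem zero_mem_steps : (0 : ℝ) ∈ steps := Set.mem_insert_of_mem _ (Set.mem_insert _ _)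

theorem one_div_mem_steps (n : ℕ) : 1 / ((n : ℝ) + 1) ∈ steps :=
  Set.mem_insert_of_mem _ (Set.mem_insert_of_mem _ ⟨n, rfl⟩)

theorem one_mem_steps : (1 : ℝ) ∈ steps := by simpa using one_div_mem_steps 0

theorem one_div_le_one (n : ℕ) : 1 / ((n : ℝ) + 1) ≤ 1 := by
  rw [div_le_one (by positivity)]
  linarith [Nat.cast_nonneg (α := ℝ) n]

theorem abs_le_one_of_mem_steps {δ : ℝ} (h : δ ∈ steps) : |δ| ≤ 1 := by
  rcases h with rfl | rfl | ⟨n, rfl⟩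
  · simp
  · simp
  · rw [abs_of_pos (by positivity)]
    exact one_div_le_one n

/-- The difference quotients of `φ` at `0` are dominated as those of a concave function, and
converge to `φ'`. -/
structure HasConcaveSlope (φ : ℝ → ℝ) (φ' : ℝ) : Prop where
  lower : ∀ δ ∈ steps, 0 < δ → δ ≤ 1 → φ 1 - φ 0 ≤ (φ δ - φ 0) / δ
  upper : ∀ δ ∈ steps, 0 < δ → δ ≤ 1 → (φ δ - φ 0) / δ ≤ φ 0 - φ (-1)
  tendsto : Tendsto (fun n : ℕ => (φ (1 / ((n : ℝ) + 1)) - φ 0) / (1 / ((n : ℝ) + 1))) atTop (𝓝 φ')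

namespace HasConcaveSlope

/-- Concavity gives both bounds, and needs only that the end points `c + y` and `c - y` stay in the
domain; differentiability at `c` serves for the limit. -/
theorem comp_affine {f : ℝ → ℝ} (hf : ConcaveOn ℝ (Set.Ioi 0) f) {c y f' : ℝ} (hc : 0 < c)
    (h1 : 0 < c + y) (h2 : 0 < c - y) (hd : HasDerivAt f f' c) :
    HasConcaveSlope (fun δ => f (c + δ * y)) (f' * y) where
  lower δ _ h0 hδ := by
    rw [le_div_iff₀ h0]
    have := hf.2 hc h1 (sub_nonneg.2 hδ) h0.le (sub_add_cancel 1 δ)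
    simp only [smul_eq_mul] at this
    rw [show (1 - δ) * c + δ * (c + y) = c + δ * y by ring] at this
    simp only [one_mul, zero_mul, add_zero]
    linarith
  upper δ _ h0 hδ := by
    rw [div_le_iff₀ h0]
    have hp : 0 < c + δ * y := by nlinarith
    have h3 : 0 < 1 + δ := by linarith
    -- The point `c` is the mean of `c + δ y` and `c - y` with weights `1 / (1 + δ)` and `δ / (1 +
    -- δ)`.
    have := hf.2 hp h2 (show 0 ≤ 1 / (1 + δ) by positivity)
      (show 0 ≤ δ / (1 + δ) by positivity) (by field_simp)
    simp only [smul_eq_mul] at this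
    rw [show 1 / (1 + δ) * (c + δ * y) + δ / (1 + δ) * (c - y) = c by field_simp; ring] at this
    have h4 : f (c + δ * y) + δ * f (c - y) ≤ (1 + δ) * f c := by
      have := mul_le_mul_of_nonneg_left this h3.le
      refine le_trans (le_of_eq ?_) this
      field_simp
    simp only [zero_mul, add_zero, neg_mul, one_mul, ← sub_eq_add_neg]
    linarith
  tendsto := by
    have h : HasDerivAt (fun δ : ℝ => f (c + δ * y)) (f' * y) 0 := by
      have hin : HasDerivAt (fun δ : ℝ => c + δ * y) y 0 := by
        simpa using ((hasDerivAt_id (0 : ℝ)).mul_const y).const_add c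
      refine HasDerivAt.comp (h := fun δ : ℝ => c + δ * y) (0 : ℝ) ?_ hin
      simpa using hd
    have := h.tendsto_slope_zero.comp
      (tendsto_nhdsWithin_iff.2 ⟨tendsto_one_div_add_atTop_nhds_zero_nat (𝕜 := ℝ),
        Eventually.of_forall fun n => by simp; positivity⟩)
    refine this.congr fun n => ?_
    simp [div_eq_inv_mul]

theorem const (c : ℝ) : HasConcaveSlope (fun _ => c) 0 where
  lower _ _ _ _ := by simp
  upper _ _ _ _ := by simp
  tendsto := by simp

theorem congr {φ ψ : ℝ → ℝ} {φ' : ℝ} (h : HasConcaveSlope φ φ') (he : ∀ δ ∈ steps, φ δ = ψ δ) :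
    HasConcaveSlope ψ φ' where
  lower δ hs h0 hδ := by
    rw [← he 1 one_mem_steps, ← he 0 zero_mem_steps, ← he δ hs]
    exact h.lower δ hs h0 hδ
  upper δ hs h0 hδ := by
    rw [← he (-1) neg_one_mem_steps, ← he 0 zero_mem_steps, ← he δ hs]
    exact h.upper δ hs h0 hδ
  tendsto := h.tendsto.congr fun n => by
    rw [← he 0 zero_mem_steps, ← he _ (one_div_mem_steps n)]

theorem const_mul {φ : ℝ → ℝ} {φ' : ℝ} (h : HasConcaveSlope φ φ') {k : ℝ} (hk : 0 ≤ k) :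
    HasConcaveSlope (fun δ => k * φ δ) (k * φ') where
  lower δ hs h0 hδ := by
    rw [← mul_sub, ← mul_sub, mul_div_assoc]
    exact mul_le_mul_of_nonneg_left (h.lower δ hs h0 hδ) hk
  upper δ hs h0 hδ := by
    rw [← mul_sub, ← mul_sub, mul_div_assoc]
    exact mul_le_mul_of_nonneg_left (h.upper δ hs h0 hδ) hk
  tendsto := by
    simp_rw [← mul_sub, mul_div_assoc]
    exact h.tendsto.const_mul k

theorem le_zero {φ : ℝ → ℝ} {φ' : ℝ} (h : HasConcaveSlope φ φ')
    (hφ : ∀ δ ∈ steps, φ δ ≤ φ 0) : φ' ≤ 0 :=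
  le_of_tendsto h.tendsto (Eventually.of_forall fun n =>
    div_nonpos_of_nonpos_of_nonneg (by linarith [hφ _ (one_div_mem_steps n)]) (by positivity))

theorem add {φ ψ : ℝ → ℝ} {φ' ψ' : ℝ} (h : HasConcaveSlope φ φ') (h2 : HasConcaveSlope ψ ψ') :
    HasConcaveSlope (fun δ => φ δ + ψ δ) (φ' + ψ') where
  lower δ hs h0 hδ := by
    have := h.lower δ hs h0 hδ
    have := h2.lower δ hs h0 hδ
    rw [add_sub_add_comm, add_sub_add_comm, add_div]
    linarith
  upper δ hs h0 hδ := by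
    have := h.upper δ hs h0 hδ
    have := h2.upper δ hs h0 hδ
    rw [add_sub_add_comm, add_sub_add_comm, add_div]
    linarith
  tendsto := by
    simp_rw [add_sub_add_comm, add_div]
    exact h.tendsto.add h2.tendsto

/-- Concave slopes may be integrated; the limit slope is integrable. -/
theorem integral {X : Type*} [MeasurableSpace X] {μ : Measure X} {φ : ℝ → X → ℝ} {φ' : X → ℝ}
    (hint : ∀ δ ∈ steps, Integrable (φ δ) μ)
    (h : ∀ᵐ x ∂μ, HasConcaveSlope (fun δ => φ δ x) (φ' x)) :
    Integrable φ' μ ∧ HasConcaveSlope (fun δ => ∫ x, φ δ x ∂μ) (∫ x, φ' x ∂μ) := by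
  have hδ : ∀ n : ℕ, (0 : ℝ) < 1 / ((n : ℝ) + 1) := fun n => by positivity
  have h0i := hint 0 zero_mem_steps
  have hq : ∀ δ ∈ steps, Integrable (fun x => (φ δ x - φ 0 x) / δ) μ :=
    fun δ hs => ((hint δ hs).sub h0i).div_const δ
  have hm : ∀ n : ℕ, AEStronglyMeasurable
      (fun x => (φ (1 / ((n : ℝ) + 1)) x - φ 0 x) / (1 / ((n : ℝ) + 1))) μ :=
    fun n => (hq _ (one_div_mem_steps n)).1
  have hl : Integrable (fun x => φ 1 x - φ 0 x) μ := (hint 1 one_mem_steps).sub h0i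
  have hu : Integrable (fun x => φ 0 x - φ (-1) x) μ := h0i.sub (hint (-1) neg_one_mem_steps)
  have hbound : ∀ n : ℕ, ∀ᵐ x ∂μ,
      ‖(φ (1 / ((n : ℝ) + 1)) x - φ 0 x) / (1 / ((n : ℝ) + 1))‖
        ≤ |φ 1 x - φ 0 x| + |φ 0 x - φ (-1) x| := by
    intro n
    filter_upwards [h] with x hx
    have a := hx.lower _ (one_div_mem_steps n) (hδ n) (one_div_le_one n)
    have b := hx.upper _ (one_div_mem_steps n) (hδ n) (one_div_le_one n)
    rw [Real.norm_eq_abs, abs_le]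
    constructor
    · linarith [neg_abs_le (φ 1 x - φ 0 x), abs_nonneg (φ 0 x - φ (-1) x)]
    · linarith [le_abs_self (φ 0 x - φ (-1) x), abs_nonneg (φ 1 x - φ 0 x)]
  have hlim : ∀ᵐ x ∂μ, Tendsto
      (fun n : ℕ => (φ (1 / ((n : ℝ) + 1)) x - φ 0 x) / (1 / ((n : ℝ) + 1))) atTop (𝓝 (φ' x)) :=
    h.mono fun x hx => hx.tendsto
  have hB := hl.abs.add hu.abs
  refine ⟨?_, ?_, ?_, ?_⟩
  · refine hB.mono' (aestronglyMeasurable_of_tendsto_ae atTop hm hlim) ?_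
    filter_upwards [ae_all_iff.2 hbound, hlim] with x h1 h2
    exact le_of_tendsto h2.norm (Eventually.of_forall h1)
  · intro δ hs h0 h1
    rw [← integral_sub (hint 1 one_mem_steps) h0i, ← integral_sub (hint δ hs) h0i, ← integral_div]
    refine integral_mono_ae hl (hq δ hs) ?_
    filter_upwards [h] with x hx using hx.lower δ hs h0 h1
  · intro δ hs h0 h1
    rw [← integral_sub h0i (hint (-1) neg_one_mem_steps), ← integral_sub (hint δ hs) h0i,
      ← integral_div]
    refine integral_mono_ae (hq δ hs) hu ?_
    filter_upwards [h] with x hx using hx.upper δ hs h0 h1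
  · refine (tendsto_integral_of_dominated_convergence _ hm hB hbound hlim).congr fun n => ?_
    rw [integral_div, integral_sub (hint _ (one_div_mem_steps n)) h0i]

/-- Concave slopes may be summed. -/
theorem tsum {φ : ℝ → ℕ → ℝ} {φ' : ℕ → ℝ} (hsum : ∀ δ ∈ steps, Summable (φ δ))
    (h : ∀ i, HasConcaveSlope (fun δ => φ δ i) (φ' i)) :
    HasConcaveSlope (fun δ => ∑' i, φ δ i) (∑' i, φ' i) := by
  -- A series is an integral against counting measure, so dominated convergence is available from
  -- `integral`.
  have hi : ∀ δ ∈ steps, Integrable (φ δ) Measure.count := fun δ hδ =>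
    integrable_count_iff.2 (hsum δ hδ).norm
  have e : ∀ f : ℕ → ℝ, Integrable f Measure.count → ∫ i, f i ∂Measure.count = ∑' i, f i :=
    fun f hf => by rw [integral_countable hf]; simp
  obtain ⟨h1, h2⟩ := integral hi (ae_of_all _ h)
  rw [e φ' h1] at h2
  exact h2.congr fun δ hδ => e _ (hi δ hδ)

end HasConcaveSlope

/-! ### Information, conditional laws of growth, and moments of future consumption. -/

section Model

variable {Ω : Type*} [mΩ : MeasurableSpace Ω] [StandardBorelSpace Ω]
  {P : Measure Ω} [IsProbabilityMeasure P]

namespace Economy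

variable (E : Economy P)

instance : IsProbabilityMeasure E.ν := E.prob_ν
instance : NullSingletonClass E.ν := E.noAtoms_ν
instance : IsMarkovKernel E.Q := E.markov_Q
instance (t : ℕ) (ω : Ω) : IsProbabilityMeasure (E.law t ω) := by unfold law; infer_instance
instance (t : ℕ) (ω : Ω) : IsProbabilityMeasure (E.lawBefore t ω) := by
  unfold lawBefore; infer_instance

/-- Joint law, given the information at date `t`, of the scenario and of the independent scenario in
which the reference point is drawn. -/
def jointLaw (t : ℕ) (ω : Ω) : Measure (Ω × Ω) := (E.law t ω).prod (E.lawBefore t ω)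

instance (t : ℕ) (ω : Ω) : IsProbabilityMeasure (E.jointLaw t ω) := by
  unfold jointLaw; infer_instance

theorem pastInfo_le (t : ℕ) : pastInfo E.ε E.Y t ≤ mΩ :=
  iSup₂_le fun s _ => ((E.measurable_ε s).prodMk (E.measurable_Y s)).comap_le

theorem pastInfo_mono {s t : ℕ} (h : s ≤ t) : pastInfo E.ε E.Y s ≤ pastInfo E.ε E.Y t :=
  iSup₂_le fun r hr => le_iSup₂_of_le r (hr.trans_le h) le_rfl

theorem info_le (t : ℕ) : E.info t ≤ mΩ := E.pastInfo_le (t + 1)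

theorem info_mono {s t : ℕ} (h : s ≤ t) : E.info s ≤ E.info t := E.pastInfo_mono (by omega)

theorem measurable_state {s t : ℕ} (h : s < t) :
    Measurable[pastInfo E.ε E.Y t] fun ω => (E.ε s ω, E.Y s ω) :=
  (comap_measurable _).mono (le_iSup₂_of_le s h le_rfl) le_rfl

theorem measurable_ε_info {s t : ℕ} (h : s < t) : Measurable[pastInfo E.ε E.Y t] (E.ε s) :=
  measurable_fst.comp (E.measurable_state h)

theorem measurable_Y_info {s t : ℕ} (h : s < t) : Measurable[pastInfo E.ε E.Y t] (E.Y s) :=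
  measurable_snd.comp (E.measurable_state h)

/-- Aggregate consumption at date `t - 1`. -/
def prevC (t : ℕ) (ω : Ω) : ℝ := E.c₀ * ∏ s ∈ Finset.range t, E.ε s ω

theorem prevC_pos (t : ℕ) (ω : Ω) : 0 < E.prevC t ω :=
  mul_pos E.c₀_pos (Finset.prod_pos fun s _ => E.ε_pos s ω)

theorem measurable_prevC (t : ℕ) : Measurable[pastInfo E.ε E.Y t] (E.prevC t) := by
  unfold prevC
  refine Measurable.const_mul ?_ _
  exact Finset.measurable_fun_prod _ fun s hs => E.measurable_ε_info (Finset.mem_range.1 hs)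

theorem C_eq (t : ℕ) (ω : Ω) : E.C t ω = E.prevC t ω * E.ε t ω := by
  rw [C, prevC, Finset.prod_range_succ, mul_assoc]

theorem C_succ (t : ℕ) (ω : Ω) : E.C (t + 1) ω = E.C t ω * E.ε (t + 1) ω := E.C_eq (t + 1) ω

theorem C_pos (t : ℕ) (ω : Ω) : 0 < E.C t ω := E.prevC_pos (t + 1) ω

theorem measurable_C_info {s t : ℕ} (h : s < t) : Measurable[pastInfo E.ε E.Y t] (E.C s) :=
  (E.measurable_prevC (s + 1)).mono (E.pastInfo_mono h) le_rfl

theorem D_pos (t : ℕ) (ω : Ω) : 0 < E.D t ω := div_pos (E.C_pos t ω) (E.Y_pos t ω)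

theorem ae_ae_law (t : ℕ) {p : Ω → Prop} (h : ∀ᵐ ω ∂P, p ω) :
    ∀ᵐ ω ∂P, ∀ᵐ ω' ∂(E.law t ω), p ω' :=
  ae_ae_condExpKernel (E.info_le t) h

theorem ae_law_eq (t : ℕ) {β : Type*} [MeasurableSpace β] [MeasurableEq β] {f : Ω → β}
    (hf : Measurable[E.info t] f) : ∀ᵐ ω ∂P, ∀ᵐ ω' ∂(E.law t ω), f ω' = f ω :=
  ae_eq_condExpKernel (E.info_le t) hf

theorem ae_jointLaw_of_law {t : ℕ} {ω : Ω} {p : Ω → Prop} (h : ∀ᵐ ω' ∂(E.law t ω), p ω') :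
    ∀ᵐ z ∂(E.jointLaw t ω), p z.1 :=
  Measure.quasiMeasurePreserving_fst.ae h

theorem ae_jointLaw_of_lawBefore {t : ℕ} {ω : Ω} {p : Ω → Prop}
    (h : ∀ᵐ ω' ∂(E.lawBefore t ω), p ω') : ∀ᵐ z ∂(E.jointLaw t ω), p z.2 :=
  Measure.quasiMeasurePreserving_snd.ae h

/-- Utilities at date `t` are known at date `t`. -/
theorem ae_utility_eq (t : ℕ) :
    ∀ᵐ ω ∂P, ∀ᵐ ω' ∂(E.law t ω), ∀ Φ : Felicity Ω, E.utility Φ t ω' = E.utility Φ t ω := by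
  filter_upwards [ae_condExpKernel_eq (P := P) le_rfl (E.info_le t),
    ae_condExpKernel_eq (P := P) (E.pastInfo_mono (Nat.le_succ t)) (E.info_le t)] with ω h1 h2
  filter_upwards [h1, h2] with ω' h1 h2 Φ
  have h1' : E.law t ω' = E.law t ω := h1
  have h2' : E.lawBefore t ω' = E.lawBefore t ω := h2
  rw [utility, utility, h1', h2']

theorem ae_law_map_state (t : ℕ) : ∀ᵐ ω ∂P,
    (E.law t ω).map (fun ω' => (E.ε (t + 1) ω', E.Y (t + 1) ω')) = E.Q (E.ε t ω, E.Y t ω) :=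
  E.law_step t

/-- After date 0 this is the constant first marginal of `Q`; at date 0 the earlier information is
trivial and the initial law takes its place. -/
theorem ae_lawBefore_map_ε (t : ℕ) : ∀ᵐ ω ∂P, (E.lawBefore t ω).map (E.ε t) = E.ν := by
  cases t with
  | zero =>
    have hbot : pastInfo E.ε E.Y 0 = ⊥ := by simp [pastInfo]
    have hp1 : ∀ ω, IsProbabilityMeasure ((E.lawBefore 0 ω).map (E.ε 0)) := fun ω =>
      Measure.isProbabilityMeasure_map (E.measurable_ε 0).aemeasurable
    have hp2 : ∀ ω : Ω, IsProbabilityMeasure E.ν := fun ω => inferInstance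
    refine ae_eq_of_forall_measurableSet (η := fun _ => E.ν) fun s hs => ?_
    filter_upwards [condExpKernel_ae_eq_condExp (μ := P) (E.pastInfo_le 0)
      (E.measurable_ε 0 hs)] with ω hω
    rw [← measureReal_eq_measureReal_iff, ← E.law_init, map_measureReal_apply (E.measurable_ε 0) hs,
      map_measureReal_apply (E.measurable_ε 0) hs, lawBefore, hω, hbot, condExp_bot,
      integral_indicator_const _ (E.measurable_ε 0 hs)]
    simp
  | succ t =>
    filter_upwards [E.law_step t] with ω hω
    rw [← E.Q_fst (E.ε t ω, E.Y t ω), ← hω, Measure.fst,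
      Measure.map_map measurable_fst ((E.measurable_ε _).prodMk (E.measurable_Y _))]
    rfl

/-- Growth rates are independent of earlier information, also under conditional laws. -/
theorem ae_indepFun {s t : ℕ} (h : s ≤ t) {f : Ω → ℝ} (hf : Measurable[E.info t] f) :
    ∀ᵐ ω ∂P, IndepFun f (E.ε (t + 1)) (E.law s ω) ∧ (E.law s ω).map (E.ε (t + 1)) = E.ν :=
  indepFun_condExpKernel (E.info_mono h) (E.info_le t) hf (E.measurable_ε _)
    (E.ae_lawBefore_map_ε (t + 1))

/-- Independence factors the integral. No integrability of `f` is needed, since the product formula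
is compatible with the default value 0 of the integral. -/
theorem ae_integral_mul_rpow {s t : ℕ} (h : s ≤ t) {f : Ω → ℝ} (hf : Measurable[E.info t] f)
    (a : ℝ) : ∀ᵐ ω ∂P, ∫ ω', f ω' * E.ε (t + 1) ω' ^ a ∂(E.law s ω)
      = (∫ ω', f ω' ∂(E.law s ω)) * ∫ x, x ^ a ∂E.ν := by
  filter_upwards [E.ae_indepFun h hf] with ω hω
  have hm : Measurable fun x : ℝ => x ^ a := measurable_id.pow_const a
  rw [← hω.2, integral_map (E.measurable_ε _).aemeasurable hm.aestronglyMeasurable]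
  exact hω.1.integral_fun_comp_mul_comp (f := id) (g := fun x : ℝ => x ^ a)
    (hf.mono (E.info_le t) le_rfl).aemeasurable (E.measurable_ε _).aemeasurable
    measurable_id.aestronglyMeasurable hm.aestronglyMeasurable

/-- Conditional expectations of future powers of aggregate consumption. -/
theorem ae_integral_mul_C_rpow (t : ℕ) {f : Ω → ℝ} (hf : Measurable[E.info (t + 1)] f) (a : ℝ)
    (i : ℕ) : ∀ᵐ ω ∂P, ∫ ω', f ω' * E.C (t + i + 1) ω' ^ a ∂(E.law t ω)
      = (∫ ω', f ω' * E.C (t + 1) ω' ^ a ∂(E.law t ω)) * (∫ x, x ^ a ∂E.ν) ^ i := by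
  induction i with
  | zero => simp
  | succ i ih =>
    have hm : Measurable[E.info (t + i + 1)] fun ω => f ω * E.C (t + i + 1) ω ^ a :=
      (hf.mono (E.info_mono (by omega)) le_rfl).mul
        ((E.measurable_C_info (Nat.lt_succ_self _)).pow_const a)
    filter_upwards [ih, E.ae_integral_mul_rpow (s := t) (by omega) hm a] with ω h1 h2
    rw [pow_succ, ← mul_assoc, ← h1, ← h2]
    refine integral_congr_ae (ae_of_all _ fun ω' => ?_)
    change f ω' * E.C (t + i + 1 + 1) ω' ^ a = _
    rw [E.C_succ, Real.mul_rpow (E.C_pos _ _).le (E.ε_pos _ _).le]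
    exact (mul_assoc _ _ _).symm

theorem ae_ν_pos : ∀ᵐ x ∂E.ν, 0 < x := by
  rw [← E.law_init, ae_map_iff (E.measurable_ε 0).aemeasurable measurableSet_Ioi]
  exact ae_of_all _ (E.ε_pos 0)

theorem integral_rpow_nonneg (a : ℝ) : 0 ≤ ∫ x, x ^ a ∂E.ν :=
  integral_nonneg_of_ae (E.ae_ν_pos.mono fun _ hx => Real.rpow_nonneg hx.le _)

theorem measurable_F : Measurable E.F := (monotone_cdf E.ν).measurable

end Economy

/-! ### Averaging the gain-loss slope over the reference draw. -/

variable (E : Economy P) (U : Preferences)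

theorem measurable_G : Measurable (G E U) := by
  unfold G
  exact E.measurable_F.add ((measurable_const.sub E.measurable_F).const_mul _)

theorem A_eq (x : ℝ) : A E U x = 1 + U.b * G E U x := by
  unfold A G; ring

theorem measurable_A : Measurable (A E U) := by
  simp_rw [funext (A_eq E U)]
  exact ((measurable_G E U).const_mul _).const_add _

theorem one_le_G (x : ℝ) : 1 ≤ G E U x := by
  have h1 : E.F x ≤ 1 := cdf_le_one E.ν x
  have h2 := U.one_le_lam
  unfold G
  nlinarith

theorem one_le_A (x : ℝ) : 1 ≤ A E U x := by
  rw [A_eq]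
  have := mul_nonneg U.b_nonneg (zero_le_one.trans (one_le_G E U x))
  linarith

theorem A_pos (x : ℝ) : 0 < A E U x := zero_lt_one.trans_le (one_le_A E U x)

theorem measurable_slope (c : ℝ) : Measurable fun q => U.slope q c := by
  unfold Preferences.slope
  exact Measurable.ite measurableSet_Iio measurable_const measurable_const

theorem integrable_slope {X : Type*} [MeasurableSpace X] (μ : Measure X) [IsFiniteMeasure μ]
    {f : X → ℝ} (hf : Measurable f) (c : ℝ) : Integrable (fun x => U.slope (f x) c) μ := by
  refine Integrable.of_bound (C := U.lam) ((measurable_slope U c).comp hf).aestronglyMeasurable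
    (ae_of_all _ fun x => ?_)
  have := U.one_le_lam
  unfold Preferences.slope
  split_ifs
  · simpa using this
  · rw [Real.norm_of_nonneg (by linarith)]

/-- The slope is 1 on `q < c` and `lam` elsewhere; without atoms the event `q < c` has probability
`F c`. -/
theorem integral_slope (c : ℝ) : ∫ q, U.slope q c ∂E.ν = G E U c := by
  have h : ∀ q, U.slope q c = U.lam + (Set.Iio c).indicator (fun _ => 1 - U.lam) q := by
    intro q
    by_cases hq : q < c <;> simp [Preferences.slope, hq]
  have h2 : E.ν.real (Set.Iio c) = E.F c := by
    rw [Economy.F, cdf_eq_real]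
    exact measureReal_congr Iio_ae_eq_Iic
  simp_rw [h]
  rw [integral_add (integrable_const _) ((integrable_const _).indicator measurableSet_Iio),
    integral_indicator_const _ measurableSet_Iio, h2]
  simp [G]
  ring

namespace Economy

/-- Almost surely the reference draw differs from actual consumption, and both differ from
consumption at the previous date by the growth rate only. -/
theorem ae_jointLaw_slope (t : ℕ) : ∀ᵐ ω ∂P, ∀ᵐ z ∂(E.jointLaw t ω),
    E.C t z.2 ≠ E.C t z.1 ∧ U.slope (E.C t z.2) (E.C t z.1) = U.slope (E.ε t z.2) (E.ε t ω) := by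
  have h1 := ae_eq_condExpKernel (P := P) (E.pastInfo_le t) (E.measurable_prevC t)
  have h2 := E.ae_law_eq t (E.measurable_C_info (Nat.lt_succ_self t))
  filter_upwards [h1, h2, E.ae_lawBefore_map_ε t] with ω h1 h2 h3
  have h4 : ∀ᵐ ω' ∂(E.lawBefore t ω), E.ε t ω' ≠ E.ε t ω := by
    have h5 : ∀ᵐ x ∂E.ν, x ≠ E.ε t ω := by
      simp [ae_iff]
    rw [← h3] at h5
    exact ae_of_ae_map (E.measurable_ε t).aemeasurable h5
  have h1' : ∀ᵐ ω' ∂(E.lawBefore t ω), E.prevC t ω' = E.prevC t ω := h1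
  filter_upwards [E.ae_jointLaw_of_law h2, E.ae_jointLaw_of_lawBefore h1',
    E.ae_jointLaw_of_lawBefore h4] with z h2 h1 h4
  have hp := E.prevC_pos t ω
  -- Both consumptions are now `prevC t ω` times a growth rate, and a common positive factor does
  -- not affect the comparison.
  rw [h2, E.C_eq t z.2, E.C_eq t ω, h1, mul_comm, mul_comm (E.prevC t ω) (E.ε t ω),
    U.slope_mul hp]
  exact ⟨fun h => h4 (mul_right_cancel₀ hp.ne' h), rfl⟩

/-- Integration of the slope of gain-loss utility over the reference draw. -/
theorem ae_integral_slope (t : ℕ) : ∀ᵐ ω ∂P, ∀ f : Ω → ℝ,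
    ∫ z, f z.1 * U.slope (E.C t z.2) (E.C t z.1) ∂(E.jointLaw t ω)
      = (∫ ω', f ω' ∂(E.law t ω)) * G E U (E.ε t ω) := by
  filter_upwards [E.ae_jointLaw_slope U t, E.ae_lawBefore_map_ε t] with ω h1 h2 f
  have : ∀ᵐ z ∂(E.jointLaw t ω), f z.1 * U.slope (E.C t z.2) (E.C t z.1)
      = f z.1 * U.slope (E.ε t z.2) (E.ε t ω) := h1.mono fun z hz => by rw [hz.2]
  rw [integral_congr_ae this, jointLaw,
    integral_prod_mul f fun ω' => U.slope (E.ε t ω') (E.ε t ω), ← integral_slope E U, ← h2,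
    integral_map (E.measurable_ε t).aemeasurable (measurable_slope U _).aestronglyMeasurable]

theorem ae_integral_one_add_slope (t : ℕ) : ∀ᵐ ω ∂P, ∀ a : ℝ,
    ∫ z, a * (1 + U.b * U.slope (E.C t z.2) (E.C t z.1)) ∂(E.jointLaw t ω)
      = a * A E U (E.ε t ω) := by
  filter_upwards [E.ae_jointLaw_slope U t, E.ae_integral_slope U t] with ω h1 h2 a
  have h3 : Integrable (fun z : Ω × Ω => U.slope (E.C t z.2) (E.C t z.1)) (E.jointLaw t ω) := by
    refine (integrable_slope U (E.jointLaw t ω) ((E.measurable_ε t).comp measurable_snd)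
      (E.ε t ω)).congr ?_
    filter_upwards [h1] with z hz using hz.2.symm
  have h4 := h2 fun _ => 1
  simp only [one_mul, integral_const, probReal_univ, smul_eq_mul] at h4
  rw [integral_const_mul, integral_add (integrable_const _) (h3.const_mul _), integral_const_mul,
    h4, A_eq]
  simp

end Economy

/-- Consuming aggregate consumption and investing exactly in the stock. -/
def Economy.marketPlan (E : Economy P) : Plan Ω := ⟨E.C, fun _ _ => 1⟩

/-! ### Wealth along the market plan and along one-period trades. -/

namespace Prices

variable {E : Economy P} (p : Prices E) (U : Preferences)

theorem g_state_pos (t : ℕ) (ω : Ω) : 0 < p.g (E.ε t ω, E.Y t ω) :=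
  p.g_pos _ _ (E.ε_pos t ω) (E.Y_pos t ω)

theorem S_pos (t : ℕ) (ω : Ω) : 0 < p.S t ω := mul_pos (p.g_state_pos t ω) (E.D_pos t ω)

theorem measurable_D_info {s t : ℕ} (h : s < t) : Measurable[pastInfo E.ε E.Y t] (E.D s) :=
  (E.measurable_C_info h).div (E.measurable_Y_info h)

theorem measurable_S_info {s t : ℕ} (h : s < t) : Measurable[pastInfo E.ε E.Y t] (p.S s) :=
  (p.measurable_g.comp (E.measurable_state h)).mul (measurable_D_info h)

theorem measurable_RS_info (t : ℕ) : Measurable[E.info (t + 1)] (p.RS t) :=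
  ((p.measurable_S_info (by omega)).add (measurable_D_info (by omega))).div
    (p.measurable_S_info (by omega))

/-- Market wealth before consumption. -/
def W (t : ℕ) (ω : Ω) : ℝ := p.S t ω + E.C t ω

theorem W_pos (t : ℕ) (ω : Ω) : 0 < p.W t ω := add_pos (p.S_pos t ω) (E.C_pos t ω)

/-- The amount invested is exactly the stock price, and dividends plus labor income make up
aggregate consumption. -/
theorem nextWealth_market (t : ℕ) (ω : Ω) :
    p.nextWealth t (p.W t ω) (E.C t ω) 1 ω = p.W (t + 1) ω := by
  have := (p.S_pos t ω).ne'
  simp only [nextWealth, W, RS, Economy.L]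
  field_simp
  ring

theorem wealth_market (t : ℕ) (ω : Ω) : p.wealth E.marketPlan t ω = p.W t ω := by
  induction t with
  | zero => simp [wealth, W, Economy.L]
  | succ t ih =>
    rw [wealth, ih]
    exact p.nextWealth_market t ω

/-- The growth factors of market wealth telescope, and the final market wealth cancels against the
consumption-wealth ratio. -/
theorem expected_market (X : Plan Ω) (t i : ℕ) (ω : Ω) :
    p.expected E.marketPlan X t (i + 1) ω
      = E.C (t + i + 1) ω * (p.wealth X (t + 1) ω / p.W (t + 1) ω) := by
  have hW := fun s => (p.W_pos s ω).ne'
  have hprod : ∏ j ∈ Finset.Icc 2 (i + 1),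
      p.wealth E.marketPlan (t + j) ω / p.wealth E.marketPlan (t + j - 1) ω
        = p.W (t + i + 1) ω / p.W (t + 1) ω := by
    simp_rw [wealth_market]
    induction i with
    | zero => simp [div_self (hW _)]
    | succ i ih =>
      rw [Finset.prod_Icc_succ_top (by omega), ih, show t + (i + 1 + 1) - 1 = t + i + 1 by omega,
        show t + (i + 1) + 1 = t + (i + 1 + 1) by omega]
      have h1 := hW (t + i + 1)
      have h2 := hW (t + 1)
      field_simp
  rw [expected, hprod, wealth_market]
  have h1 := hW (t + i + 1)
  have h2 := hW (t + 1)
  change E.C (t + i + 1) ω / p.W (t + i + 1) ω * _ * _ = _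
  field_simp

/-- Marginal change of wealth at date `t + 1` when the change of consumption and of the portfolio at
date `t` has direction `(u, v)`. -/
def gain (t : ℕ) (u v : Ω → ℝ) (ω : Ω) : ℝ :=
  -u ω * p.RS t ω + v ω * p.S t ω * (p.RS t ω - p.Rf t ω)

theorem measurable_gain (t : ℕ) {u v : Ω → ℝ} (hu : Measurable[E.info t] u)
    (hv : Measurable[E.info t] v) : Measurable[E.info (t + 1)] (p.gain t u v) := by
  have hle := E.info_mono (Nat.le_succ t)
  have h1 := p.measurable_RS_info t
  exact ((hu.mono hle le_rfl).neg.mul h1).add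
    (((hv.mono hle le_rfl).mul (p.measurable_S_info (by omega))).mul
      (h1.sub ((p.adapted_Rf t).mono hle le_rfl)))

/-- The plan that departs from the market plan at date `t` by `δ` in the direction `(u, v)`. -/
def trade (t : ℕ) (u v : Ω → ℝ) (δ : ℝ) : Plan Ω :=
  p.detour E.marketPlan t (fun ω => E.C t ω + δ * u ω) (fun ω => 1 + δ * v ω)

/-- Second-order part of the change of wealth. -/
def cross (t : ℕ) (u v : Ω → ℝ) (ω : Ω) : ℝ := u ω * v ω * (p.RS t ω - p.Rf t ω)

variable (t : ℕ) (u v : Ω → ℝ) (δ : ℝ)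

theorem wealth_trade_of_le {s : ℕ} (hs : s ≤ t) (ω : Ω) :
    p.wealth (p.trade t u v δ) s ω = p.W s ω := by
  rw [← wealth_market]
  induction s with
  | zero => rfl
  | succ s ih =>
    have h1 : ¬ s = t := by omega
    have h2 : ¬ s = t + 1 := by omega
    simp only [wealth]
    rw [ih (by omega)]
    simp [trade, detour, h1, h2]

theorem wealth_trade_succ (ω : Ω) : p.wealth (p.trade t u v δ) (t + 1) ω
    = p.W (t + 1) ω + (δ * p.gain t u v ω - δ ^ 2 * p.cross t u v ω) := by
  rw [wealth, wealth_trade_of_le p t u v δ le_rfl, ← p.nextWealth_market t ω]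
  simp only [trade, detour, nextWealth, gain, cross, W, if_true]
  ring

theorem C_trade_self (ω : Ω) : (p.trade t u v δ).C t ω = E.C t ω + δ * u ω := by
  simp [trade, detour]

theorem C_trade_succ (ω : Ω) : (p.trade t u v δ).C (t + 1) ω
    = E.C (t + 1) ω + (δ * p.gain t u v ω - δ ^ 2 * p.cross t u v ω) := by
  have h := p.wealth_trade_succ t u v δ ω
  rw [wealth, wealth_trade_of_le p t u v δ le_rfl] at h
  have h2 : (p.trade t u v δ).C (t + 1) ω = E.C (t + 1) ω
      + (p.nextWealth t (p.W t ω) ((p.trade t u v δ).C t ω) ((p.trade t u v δ).α t ω) ω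
        - p.W (t + 1) ω) := by
    rw [← wealth_market, ← wealth_market]
    simp [trade, detour, Economy.marketPlan]
  rw [h2, h]
  ring

theorem C_trade_of_ne {s : ℕ} (h1 : s ≠ t) (h2 : s ≠ t + 1) :
    (p.trade t u v δ).C s = E.C s := by
  funext ω
  simp [trade, detour, h1, h2, Economy.marketPlan]

theorem α_trade_of_ne {s : ℕ} (h1 : s ≠ t) : (p.trade t u v δ).α s = fun _ => 1 := by
  funext ω
  simp [trade, detour, h1, Economy.marketPlan]

/-- Consumption at `t + 1` absorbs the whole change of wealth, so the amount invested at `t + 1` is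
again that of the market plan. -/
theorem wealth_trade_of_lt {s : ℕ} (hs : t + 2 ≤ s) (ω : Ω) :
    p.wealth (p.trade t u v δ) s ω = p.W s ω := by
  induction s, hs using Nat.le_induction with
  | base =>
    rw [wealth, wealth_trade_succ, C_trade_succ, α_trade_of_ne p t u v δ (by omega),
      ← p.nextWealth_market (t + 1) ω]
    simp only [nextWealth]
    ring
  | succ s hs ih =>
    rw [wealth, ih, C_trade_of_ne p t u v δ (by omega) (by omega),
      α_trade_of_ne p t u v δ (by omega), nextWealth_market]

theorem trade_zero : p.trade t u v 0 = E.marketPlan := by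
  have hC : (p.trade t u v 0).C = E.C := by
    funext s ω
    rcases eq_or_ne s t with rfl | h1
    · rw [C_trade_self]; ring
    · rcases eq_or_ne s (t + 1) with rfl | h2
      · rw [C_trade_succ]; ring
      · rw [C_trade_of_ne p t u v 0 h1 h2]
  have hα : (p.trade t u v 0).α = fun _ _ => 1 := by
    funext s ω
    simp [trade, detour, Economy.marketPlan]
  calc p.trade t u v 0 = ⟨(p.trade t u v 0).C, (p.trade t u v 0).α⟩ := rfl
    _ = _ := by rw [hC, hα]; rfl

theorem now_trade_self (ω ω' : Ω) : (p.felicity U E.marketPlan (p.trade t u v δ)).now t ω ω'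
    = U.total (E.C t ω') (E.C t ω + δ * u ω) := by
  simp only [felicity, C_trade_self, Preferences.total]
  rfl

theorem now_trade_succ (ω ω' : Ω) :
    (p.felicity U E.marketPlan (p.trade t u v δ)).now (t + 1) ω ω'
      = U.total (E.C (t + 1) ω')
        (E.C (t + 1) ω + (δ * p.gain t u v ω - δ ^ 2 * p.cross t u v ω)) := by
  simp only [felicity, C_trade_succ, Preferences.total]
  rfl

theorem now_trade_of_ne {s : ℕ} (h1 : s ≠ t) (h2 : s ≠ t + 1) :
    (p.felicity U E.marketPlan (p.trade t u v δ)).now s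
      = (p.felicity U E.marketPlan E.marketPlan).now s := by
  funext ω ω'
  simp only [felicity, C_trade_of_ne p t u v δ h1 h2]
  rfl

theorem ahead_trade_self (i : ℕ) (ω ω' : Ω) :
    (p.felicity U E.marketPlan (p.trade t u v δ)).ahead t i ω ω'
      = U.γ * U.β ^ (i + 1) *
        U.gl (U.m (E.C (t + i + 1) ω + (δ * p.gain t u v ω - δ ^ 2 * p.cross t u v ω)
            * (E.C (t + i + 1) ω / p.W (t + 1) ω))
          - U.m (E.C t ω' * (E.C (t + i + 1) ω / E.C t ω))) := by
  simp only [felicity, expected_market, wealth_trade_succ]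
  have := (p.W_pos (t + 1) ω).ne'
  rw [show E.C (t + i + 1) ω * ((p.W (t + 1) ω + (δ * p.gain t u v ω - δ ^ 2 * p.cross t u v ω))
      / p.W (t + 1) ω) = E.C (t + i + 1) ω + (δ * p.gain t u v ω - δ ^ 2 * p.cross t u v ω)
            * (E.C (t + i + 1) ω / p.W (t + 1) ω) by field_simp]
  rfl

/-- Prospective utility at `s` sees the plan only through wealth at `s + 1`, which the trade moves
for `s = t` alone. -/
theorem ahead_trade_of_ne {s : ℕ} (h : s ≠ t) :
    (p.felicity U E.marketPlan (p.trade t u v δ)).ahead s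
      = (p.felicity U E.marketPlan E.marketPlan).ahead s := by
  have : p.wealth (p.trade t u v δ) (s + 1) = p.wealth E.marketPlan (s + 1) := by
    funext ω
    rw [wealth_market]
    rcases lt_or_gt_of_ne h with h | h
    · exact wealth_trade_of_le p t u v δ h ω
    · exact wealth_trade_of_lt p t u v δ (by omega) ω
  funext i ω ω'
  simp only [felicity, expected_market, this]

/-- Marginal utility of a small trade in the direction `(u, v)`. -/
def tradeSlope : Felicity Ω where
  now s ω ω' := if s = t then E.C t ω ^ (-U.θ) * u ω * (1 + U.b * U.slope (E.C t ω') (E.C t ω))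
    else if s = t + 1 then E.C (t + 1) ω ^ (-U.θ) * p.gain t u v ω
      * (1 + U.b * U.slope (E.C (t + 1) ω') (E.C (t + 1) ω))
    else 0
  ahead s i ω ω' := if s = t then U.γ * U.β ^ (i + 1) *
      (p.gain t u v ω / p.W (t + 1) ω * E.C (t + i + 1) ω ^ (1 - U.θ)
        * U.slope (E.C t ω') (E.C t ω))
    else 0

variable {t u v}

theorem hasDerivAt_path (x y z : ℝ) :
    HasDerivAt (fun δ : ℝ => x + (δ * y - δ ^ 2 * z)) y 0 := by
  have h1 : HasDerivAt (fun δ : ℝ => δ * y) (1 * y) 0 := (hasDerivAt_id' (0 : ℝ)).mul_const y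
  have h2 := ((hasDerivAt_pow 2 (0 : ℝ)).mul_const z)
  simpa using (h1.sub h2).const_add x

/-- The reference for date `t + i + 1` is the draw for date `t` scaled by realized consumption
growth, so gain or loss is the same at all horizons. -/
theorem ahead_slope_eq (i : ℕ) (ω ω' : Ω) :
    U.slope (E.C t ω' * (E.C (t + i + 1) ω / E.C t ω)) (E.C (t + i + 1) ω)
        * E.C (t + i + 1) ω ^ (-U.θ) * (p.gain t u v ω * (E.C (t + i + 1) ω / p.W (t + 1) ω))
      = p.gain t u v ω / p.W (t + 1) ω * E.C (t + i + 1) ω ^ (1 - U.θ)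
        * U.slope (E.C t ω') (E.C t ω) := by
  have h0 := E.C_pos (t + i + 1) ω
  have h1 := E.C_pos t ω
  have h2 : U.slope (E.C t ω' * (E.C (t + i + 1) ω / E.C t ω)) (E.C (t + i + 1) ω)
      = U.slope (E.C t ω') (E.C t ω) := by
    rw [← U.slope_mul (q := E.C t ω') (div_pos h0 h1), mul_div_cancel₀ _ h1.ne']
  rw [h2, sub_eq_add_neg, Real.rpow_add h0, Real.rpow_one]
  ring

theorem reference_ne {ω ω' : Ω} (h : E.C t ω' ≠ E.C t ω) (i : ℕ) :
    E.C t ω' * (E.C (t + i + 1) ω / E.C t ω) ≠ E.C (t + i + 1) ω := by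
  have h0 := E.C_pos (t + i + 1) ω
  have h1 := E.C_pos t ω
  intro h'
  rw [mul_div_assoc', div_eq_iff h1.ne', mul_comm] at h'
  exact h (mul_left_cancel₀ h0.ne' h')

theorem hasDerivAt_now_self {ω ω' : Ω} (h : E.C t ω' ≠ E.C t ω) :
    HasDerivAt (fun δ => (p.felicity U E.marketPlan (p.trade t u v δ)).now t ω ω')
      ((p.tradeSlope U t u v).now t ω ω') 0 := by
  simp only [now_trade_self, tradeSlope, if_true]
  have hd := U.hasDerivAt_total (E.C_pos t ω') (E.C_pos t ω) h
  have hp := hasDerivAt_path (E.C t ω) (u ω) 0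
  simp only [mul_zero, sub_zero] at hp
  have := HasDerivAt.comp (0 : ℝ) (h := fun δ : ℝ => E.C t ω + δ * u ω) (by simpa using hd) hp
  rw [mul_right_comm]
  exact this

theorem hasDerivAt_now_succ {ω ω' : Ω} (h : E.C (t + 1) ω' ≠ E.C (t + 1) ω) :
    HasDerivAt (fun δ => (p.felicity U E.marketPlan (p.trade t u v δ)).now (t + 1) ω ω')
      ((p.tradeSlope U t u v).now (t + 1) ω ω') 0 := by
  simp only [now_trade_succ, tradeSlope, if_true, Nat.succ_ne_self, if_false]
  have hd := U.hasDerivAt_total (E.C_pos (t + 1) ω') (E.C_pos (t + 1) ω) h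
  have hp := hasDerivAt_path (E.C (t + 1) ω) (p.gain t u v ω) (p.cross t u v ω)
  have := HasDerivAt.comp (0 : ℝ) (h := fun δ : ℝ => E.C (t + 1) ω
    + (δ * p.gain t u v ω - δ ^ 2 * p.cross t u v ω)) (by simpa using hd) hp
  rw [mul_right_comm]
  exact this

theorem hasDerivAt_ahead_self {ω ω' : Ω} (h : E.C t ω' ≠ E.C t ω) (i : ℕ) :
    HasDerivAt (fun δ => (p.felicity U E.marketPlan (p.trade t u v δ)).ahead t i ω ω')
      ((p.tradeSlope U t u v).ahead t i ω ω') 0 := by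
  simp only [ahead_trade_self, tradeSlope, if_true]
  have h0 := E.C_pos (t + i + 1) ω
  have hd := U.hasDerivAt_gl_m_sub
    (mul_pos (E.C_pos t ω') (div_pos h0 (E.C_pos t ω))) h0 (reference_ne h i)
  have hp := hasDerivAt_path (E.C (t + i + 1) ω)
    (p.gain t u v ω * (E.C (t + i + 1) ω / p.W (t + 1) ω))
    (p.cross t u v ω * (E.C (t + i + 1) ω / p.W (t + 1) ω))
  simp only [← mul_assoc (_ : ℝ) _ (E.C (t + i + 1) ω / p.W (t + 1) ω), ← sub_mul] at hp
  have := (HasDerivAt.comp (0 : ℝ) (h := fun δ : ℝ => E.C (t + i + 1) ω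
    + (δ * p.gain t u v ω - δ ^ 2 * p.cross t u v ω) * (E.C (t + i + 1) ω / p.W (t + 1) ω))
    (by simpa using hd) hp).const_mul (U.γ * U.β ^ (i + 1))
  rw [p.ahead_slope_eq] at this
  exact this

end Prices

/-! ### From optimality to the absence of profitable small trades. -/

namespace Economy

variable (E : Economy P)

/-- The expectations and series in the utility at date `s` converge absolutely. -/
def UtilityConverges (Φ : Felicity Ω) (s : ℕ) (ω : Ω) : Prop :=
  Integrable (fun z : Ω × Ω => Φ.now s z.1 z.2) (E.jointLaw s ω) ∧
    (∀ i, Integrable (fun z : Ω × Ω => Φ.ahead s i z.1 z.2) (E.jointLaw s ω)) ∧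
    Summable fun i => ∫ z, |Φ.ahead s i z.1 z.2| ∂(E.jointLaw s ω)

theorem utility_hasConcaveSlope {Φ : ℝ → Felicity Ω} {Ψ : Felicity Ω} {s : ℕ} {ω : Ω}
    (hconv : ∀ δ ∈ steps, E.UtilityConverges (Φ δ) s ω)
    (hslope : ∀ᵐ z ∂(E.jointLaw s ω),
      HasConcaveSlope (fun δ => (Φ δ).now s z.1 z.2) (Ψ.now s z.1 z.2) ∧
      ∀ i, HasConcaveSlope (fun δ => (Φ δ).ahead s i z.1 z.2) (Ψ.ahead s i z.1 z.2)) :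
    HasConcaveSlope (fun δ => E.utility (Φ δ) s ω) (E.utility Ψ s ω) := by
  have h1 := (HasConcaveSlope.integral (φ := fun δ z => (Φ δ).now s z.1 z.2)
    (fun δ hδ => (hconv δ hδ).1) (hslope.mono fun z hz => hz.1)).2
  have h2 := fun i => (HasConcaveSlope.integral (φ := fun δ z => (Φ δ).ahead s i z.1 z.2)
    (fun δ hδ => (hconv δ hδ).2.1 i) (hslope.mono fun z hz => hz.2 i)).2
  refine h1.add (HasConcaveSlope.tsum (fun δ hδ => ?_) h2)
  exact Summable.of_norm_bounded (hconv δ hδ).2.2 fun i => norm_integral_le_integral_norm _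

/-- The cumulative utility as a series of expectations. -/
theorem value_eq_tsum {β : ℝ} (hβ : 0 < β) {Φ : Felicity Ω} {t : ℕ} {ω : Ω}
    (h1 : ∀ n, Integrable (E.utility Φ (t + n)) (E.law t ω))
    (h2 : Summable fun n => β ^ n * ∫ ω', |E.utility Φ (t + n) ω'| ∂(E.law t ω)) :
    (Summable fun n => β ^ n * ∫ ω', E.utility Φ (t + n) ω' ∂(E.law t ω)) ∧
    E.value β Φ t ω = ∑' n, β ^ n * ∫ ω', E.utility Φ (t + n) ω' ∂(E.law t ω) := by
  have h := hasSum_integral_of_summable_integral_norm (μ := E.law t ω)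
    (F := fun n ω' => β ^ n * E.utility Φ (t + n) ω') (fun n => (h1 n).const_mul _) (by
      refine h2.congr fun n => ?_
      rw [← integral_const_mul]
      simp only [norm_mul, Real.norm_eq_abs, abs_of_pos (pow_pos hβ n)])
  simp only [integral_const_mul] at h
  exact ⟨h.summable, h.tsum_eq.symm⟩

end Economy

namespace Prices

variable {E : Economy P} (p : Prices E) (U : Preferences)

/-- The expected marginal cumulative utility of a trade at date `t` in the direction `(u, v)`
is not positive. -/
def NotProfitable (t : ℕ) (u v : Ω → ℝ) : Prop :=
  ∀ᵐ ω ∂P, (∀ n, Integrable (E.utility (p.tradeSlope U t u v) (t + n)) (E.law t ω)) ∧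
    ∑' n, U.β ^ n * ∫ ω', E.utility (p.tradeSlope U t u v) (t + n) ω' ∂(E.law t ω) ≤ 0

/-- Off the null event of ties, the scenario-wise derivative is `tradeSlope`, so utilities and their
convergence carry over. -/
theorem notProfitable_of_isMarginallyOptimal (h : p.IsMarginallyOptimal U E.marketPlan)
    (t : ℕ) (u v : ℝ) : p.NotProfitable U t (fun _ => u) (fun _ => v) := by
  obtain ⟨hconv, hval⟩ := h t u v
  set Ξ := p.marginal U E.marketPlan (p.trade t (fun _ => u) (fun _ => v)) with hΞ
  set Ψ := p.tradeSlope U t (fun _ => u) (fun _ => v) with hΨ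
  have hconv' : E.Converges U.β Ξ t := hconv
  have hval' : ∀ᵐ ω ∂P, E.value U.β Ξ t ω ≤ 0 := hval
  have hnow : ∀ s ω ω', E.C s ω' ≠ E.C s ω → Ξ.now s ω ω' = Ψ.now s ω ω' := by
    intro s ω ω' hne
    rcases eq_or_ne s t with rfl | h1
    · exact (p.hasDerivAt_now_self U hne).deriv
    rcases eq_or_ne s (t + 1) with rfl | h2
    · exact (p.hasDerivAt_now_succ U hne).deriv
    · simp [hΞ, hΨ, marginal, tradeSlope, now_trade_of_ne p U t _ _ _ h1 h2, h1, h2]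
  have hahead : ∀ s i ω ω', E.C s ω' ≠ E.C s ω → Ξ.ahead s i ω ω' = Ψ.ahead s i ω ω' := by
    intro s i ω ω' hne
    rcases eq_or_ne s t with rfl | h1
    · exact (p.hasDerivAt_ahead_self U hne i).deriv
    · simp [hΞ, hΨ, marginal, tradeSlope, ahead_trade_of_ne p U t _ _ _ h1, h1]
  have hutil : ∀ s, ∀ᵐ ω ∂P, E.utility Ξ s ω = E.utility Ψ s ω := by
    intro s
    filter_upwards [E.ae_jointLaw_slope U s] with ω hω
    unfold Economy.utility
    congr 1
    · exact integral_congr_ae (hω.mono fun z hz => hnow s z.1 z.2 hz.1)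
    · exact tsum_congr fun i => integral_congr_ae (hω.mono fun z hz => hahead s i z.1 z.2 hz.1)
  have hutil' : ∀ᵐ ω ∂P, ∀ n, E.utility Ξ (t + n) =ᵐ[E.law t ω] E.utility Ψ (t + n) :=
    ae_all_iff.2 fun n => E.ae_ae_law t (hutil (t + n))
  filter_upwards [hconv'.2, hval', hutil'] with ω h1 h2 h3
  refine ⟨fun n => (h1.1 n).congr (h3 n), ?_⟩
  rw [(E.value_eq_tsum U.β_pos h1.1 h1.2).2] at h2
  refine le_of_eq_of_le (tsum_congr fun n => ?_) h2
  rw [integral_congr_ae (h3 n)]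

variable {t : ℕ} {u v : Ω → ℝ}

theorem hasConcaveSlope_now {ω ω' : Ω} (s : ℕ) (huv : u ω * v ω = 0)
    (hC : 0 < E.C t ω + u ω ∧ 0 < E.C t ω - u ω)
    (hC' : 0 < E.C (t + 1) ω + p.gain t u v ω ∧ 0 < E.C (t + 1) ω - p.gain t u v ω)
    (h : E.C s ω' ≠ E.C s ω) :
    HasConcaveSlope (fun δ => (p.felicity U E.marketPlan (p.trade t u v δ)).now s ω ω')
      ((p.tradeSlope U t u v).now s ω ω') := by
  rcases eq_or_ne s t with rfl | h1
  · simp only [now_trade_self, tradeSlope, if_true]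
    rw [mul_right_comm]
    exact HasConcaveSlope.comp_affine (U.concaveOn_total _) (E.C_pos _ _) hC.1 hC.2
      (U.hasDerivAt_total (E.C_pos _ ω') (E.C_pos _ ω) h)
  rcases eq_or_ne s (t + 1) with rfl | h2
  · simp only [now_trade_succ, tradeSlope, if_true, Nat.succ_ne_self, if_false, cross, huv,
      zero_mul, mul_zero, sub_zero]
    rw [mul_right_comm]
    exact HasConcaveSlope.comp_affine (U.concaveOn_total _) (E.C_pos _ _) hC'.1 hC'.2
      (U.hasDerivAt_total (E.C_pos _ ω') (E.C_pos _ ω) h)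
  · simp only [now_trade_of_ne p U t _ _ _ h1 h2, tradeSlope, h1, h2, if_false]
    exact HasConcaveSlope.const _

theorem hasConcaveSlope_ahead {ω ω' : Ω} (s i : ℕ) (huv : u ω * v ω = 0)
    (hW : 0 < p.W (t + 1) ω + p.gain t u v ω ∧ 0 < p.W (t + 1) ω - p.gain t u v ω)
    (h : E.C s ω' ≠ E.C s ω) :
    HasConcaveSlope (fun δ => (p.felicity U E.marketPlan (p.trade t u v δ)).ahead s i ω ω')
      ((p.tradeSlope U t u v).ahead s i ω ω') := by
  rcases eq_or_ne s t with rfl | h1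
  · simp only [ahead_trade_self, tradeSlope, if_true, cross, huv, zero_mul, mul_zero, sub_zero]
    have h0 := E.C_pos (s + i + 1) ω
    have hWp := p.W_pos (s + 1) ω
    have hr := div_pos h0 hWp
    have e : E.C (s + i + 1) ω = p.W (s + 1) ω * (E.C (s + i + 1) ω / p.W (s + 1) ω) := by
      field_simp
    have hplus : 0 < E.C (s + i + 1) ω
        + p.gain s u v ω * (E.C (s + i + 1) ω / p.W (s + 1) ω) := by
      nth_rewrite 1 [e]
      rw [← add_mul]
      exact mul_pos hW.1 hr
    have hminus : 0 < E.C (s + i + 1) ω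
        - p.gain s u v ω * (E.C (s + i + 1) ω / p.W (s + 1) ω) := by
      nth_rewrite 1 [e]
      rw [← sub_mul]
      exact mul_pos hW.2 hr
    have := (HasConcaveSlope.comp_affine (U.concaveOn_gl_m_sub _) h0 hplus hminus
      (U.hasDerivAt_gl_m_sub (mul_pos (E.C_pos s ω') (div_pos h0 (E.C_pos s ω))) h0
        (reference_ne h i))).const_mul
        (mul_nonneg U.γ_nonneg (pow_pos U.β_pos (i + 1)).le)
    rw [p.ahead_slope_eq] at this
    simpa only [mul_assoc] using this
  · simp only [ahead_trade_of_ne p U t _ _ _ h1, tradeSlope, h1, if_false]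
    exact HasConcaveSlope.const _

/-- The condition `huv` removes the quadratic term `cross`. Wealth is then affine in `δ`, and
concavity justifies every exchange of limit and expectation. -/
theorem notProfitable_of_isMaximal (hmax : p.IsMaximal U E.marketPlan)
    (hadm : ∀ δ ∈ steps, p.Admissible U E.marketPlan (p.trade t u v δ) t)
    (huv : ∀ ω, u ω * v ω = 0) : p.NotProfitable U t u v := by
  set Φ : ℝ → Felicity Ω := fun δ => p.felicity U E.marketPlan (p.trade t u v δ) with hΦ
  set Ψ := p.tradeSlope U t u v with hΨ
  have hval : ∀ᵐ ω ∂P, ∀ δ ∈ steps, E.value U.β (Φ δ) t ω ≤ E.value U.β (Φ 0) t ω := by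
    -- Optimality holds almost surely for each `δ` separately; countability of the step sizes gives
    -- one null set for all.
    rw [ae_ball_iff countable_steps]
    intro δ hδ
    simp only [hΦ, trade_zero]
    refine (hmax t).2 _ (fun s hs => ⟨?_, ?_⟩) (hadm δ hδ)
    · exact p.C_trade_of_ne t u v δ (by omega) (by omega)
    · exact p.α_trade_of_ne t u v δ (by omega)
  have hconv : ∀ n, ∀ᵐ ω ∂P, ∀ δ ∈ steps, E.UtilityConverges (Φ δ) (t + n) ω := by
    intro n
    rw [ae_ball_iff countable_steps]
    exact fun δ hδ => (hadm δ hδ).2.2.1 (t + n) (by omega)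
  have hconv' : ∀ᵐ ω ∂P, ∀ δ ∈ steps,
      (∀ n, Integrable (E.utility (Φ δ) (t + n)) (E.law t ω)) ∧
      Summable fun n => U.β ^ n * ∫ ω', |E.utility (Φ δ) (t + n) ω'| ∂(E.law t ω) := by
    rw [ae_ball_iff countable_steps]
    exact fun δ hδ => (hadm δ hδ).2.2.2
  have hpos : ∀ᵐ ω ∂P, (0 < E.C t ω + u ω ∧ 0 < E.C t ω - u ω) ∧
      (0 < E.C (t + 1) ω + p.gain t u v ω ∧ 0 < E.C (t + 1) ω - p.gain t u v ω) ∧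
      (0 < p.W (t + 1) ω + p.gain t u v ω ∧ 0 < p.W (t + 1) ω - p.gain t u v ω) := by
    -- Admissibility of the two extreme trades supplies the positive end points required by
    -- `comp_affine`.
    have hp := (hadm 1 one_mem_steps).2.1
    have hm := (hadm (-1) neg_one_mem_steps).2.1
    filter_upwards [hp t le_rfl, hm t le_rfl, hp (t + 1) (by omega), hm (t + 1) (by omega)]
      with ω h1 h2 h3 h4
    simp only [C_trade_self, C_trade_succ, wealth_trade_succ, cross, huv, zero_mul, mul_zero,
      sub_zero, one_mul, neg_mul, ← sub_eq_add_neg] at h1 h2 h3 h4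
    exact ⟨⟨h1.1, h2.1⟩, ⟨h3.1, h4.1⟩, ⟨h3.2, h4.2⟩⟩
  have hutil : ∀ n, ∀ᵐ ω ∂P,
      HasConcaveSlope (fun δ => E.utility (Φ δ) (t + n) ω) (E.utility Ψ (t + n) ω) := by
    intro n
    filter_upwards [hconv n, E.ae_jointLaw_slope U (t + n), E.ae_ae_law (t + n) hpos]
      with ω h1 h2 h3
    refine E.utility_hasConcaveSlope h1 ?_
    filter_upwards [h2, E.ae_jointLaw_of_law h3] with z h2 h3
    exact ⟨p.hasConcaveSlope_now U _ (huv _) h3.1 h3.2.1 h2.1,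
      fun i => p.hasConcaveSlope_ahead U _ i (huv _) h3.2.2 h2.1⟩
  have hutil' : ∀ᵐ ω ∂P, ∀ n, ∀ᵐ ω' ∂(E.law t ω),
      HasConcaveSlope (fun δ => E.utility (Φ δ) (t + n) ω') (E.utility Ψ (t + n) ω') :=
    ae_all_iff.2 fun n => E.ae_ae_law t (hutil n)
  filter_upwards [hval, hconv', hutil'] with ω h1 h2 h3
  have h4 := fun n => HasConcaveSlope.integral (fun δ hδ => (h2 δ hδ).1 n) (h3 n)
  have h5 := fun δ hδ => E.value_eq_tsum U.β_pos (h2 δ hδ).1 (h2 δ hδ).2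
  refine ⟨fun n => (h4 n).1, ?_⟩
  refine ((HasConcaveSlope.tsum (fun δ hδ => (h5 δ hδ).1)
    fun n => (h4 n).2.const_mul (pow_pos U.β_pos n).le).congr
      fun δ hδ => (h5 δ hδ).2.symm).le_zero h1

/-- In equilibrium no small trade of current against future consumption, or of the stock against
the risk-free asset, is profitable. -/
theorem exists_notProfitable (hp : p.IsEquilibrium U) (t : ℕ) :
    ∃ η : Ω → ℝ, Measurable[E.info t] η ∧ (∀ ω, 0 < η ω) ∧
      ∀ k : ℝ, |k| ≤ 1 → p.NotProfitable U t (fun ω => k * η ω) (fun _ => 0) ∧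
        p.NotProfitable U t (fun _ => 0) (fun ω => k * η ω) := by
  obtain ⟨star, hopt, hC, hα⟩ := hp
  have hstar : star = E.marketPlan := by
    have h1 : star.C = E.C := by funext t ω; exact hC t ω
    have h2 : star.α = fun _ _ => 1 := by funext t ω; exact hα t ω
    calc star = ⟨star.C, star.α⟩ := rfl
      _ = _ := by rw [h1, h2]; rfl
  subst hstar
  rcases hopt with ⟨hmax, hint⟩ | hopt
  · obtain ⟨η, hη, hpos, hadm⟩ := hint t
    refine ⟨η, hη, hpos, fun k hk => ?_⟩
    have hb : ∀ δ ∈ steps, ∀ ω, |δ * (k * η ω)| ≤ η ω := by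
      intro δ hδ ω
      rw [abs_mul, abs_mul, abs_of_pos (hpos ω), ← mul_assoc]
      exact mul_le_of_le_one_left (hpos ω).le
        (mul_le_one₀ (abs_le_one_of_mem_steps hδ) (abs_nonneg k) hk)
    have hCm : Measurable[E.info t] (E.C t) := E.measurable_C_info (Nat.lt_succ_self t)
    constructor
    · refine p.notProfitable_of_isMaximal U hmax (fun δ hδ => ?_) fun ω => mul_zero _
      refine hadm _ _ (hCm.add ((hη.const_mul k).const_mul δ)) measurable_const
        (fun ω => ?_) fun ω => ?_
      · simpa [Economy.marketPlan] using hb δ hδ ω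
      · simpa [Economy.marketPlan] using (hpos ω).le
    · refine p.notProfitable_of_isMaximal U hmax (fun δ hδ => ?_) fun ω => zero_mul _
      refine hadm _ _ ?_ (((hη.const_mul k).const_mul δ).const_add 1)
        (fun ω => ?_) fun ω => ?_
      · simpa using hCm
      · simpa [Economy.marketPlan] using (hpos ω).le
      · simpa [Economy.marketPlan] using hb δ hδ ω
  · refine ⟨fun _ => 1, measurable_const, fun _ => one_pos, fun k _ => ?_⟩
    simp only [mul_one]
    exact ⟨p.notProfitable_of_isMarginallyOptimal U hopt t k 0,
      p.notProfitable_of_isMarginallyOptimal U hopt t 0 k⟩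

end Prices

/-! ### Marginal utility in closed form and the Euler equations. -/

namespace Prices

variable {E : Economy P} (p : Prices E) (U : Preferences) {t : ℕ} {u v : Ω → ℝ}

theorem ae_utility_tradeSlope_succ (hu : Measurable[E.info t] u) (hv : Measurable[E.info t] v) :
    ∀ᵐ ω ∂P, E.utility (p.tradeSlope U t u v) (t + 1) ω
      = E.C (t + 1) ω ^ (-U.θ) * p.gain t u v ω * A E U (E.ε (t + 1) ω) := by
  have hm : Measurable[E.info (t + 1)] fun ω => E.C (t + 1) ω ^ (-U.θ) * p.gain t u v ω :=
    ((E.measurable_C_info (Nat.lt_succ_self _)).pow_const _).mul (p.measurable_gain t hu hv)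
  filter_upwards [E.ae_law_eq (t + 1) hm, E.ae_integral_one_add_slope U (t + 1)] with ω h1 h2
  rw [← h2, Economy.utility]
  simp only [tradeSlope, Nat.succ_ne_self, if_true, if_false, integral_zero, tsum_zero, add_zero]
  refine integral_congr_ae ?_
  filter_upwards [E.ae_jointLaw_of_law h1] with z hz
  rw [hz]

theorem utility_tradeSlope_of_lt (n : ℕ) (ω : Ω) :
    E.utility (p.tradeSlope U t u v) (t + (n + 2)) ω = 0 := by
  simp [Economy.utility, tradeSlope]

theorem ae_utility_tradeSlope_self (hgrowth : U.β * ∫ x, x ^ (1 - U.θ) ∂E.ν < 1)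
    (hu : Measurable[E.info t] u) (hv : Measurable[E.info t] v) :
    ∀ᵐ ω ∂P, E.utility (p.tradeSlope U t u v) t ω
      = E.C t ω ^ (-U.θ) * u ω * A E U (E.ε t ω)
        + U.γ * G E U (E.ε t ω) * (U.β / κ E U)
          * ∫ ω', p.gain t u v ω' / p.W (t + 1) ω' * E.C (t + 1) ω' ^ (1 - U.θ) ∂(E.law t ω) := by
  have hm : Measurable[E.info t] fun ω => E.C t ω ^ (-U.θ) * u ω :=
    ((E.measurable_C_info (Nat.lt_succ_self _)).pow_const _).mul hu
  have hg : Measurable[E.info (t + 1)] fun ω => p.gain t u v ω / p.W (t + 1) ω :=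
    (p.measurable_gain t hu hv).div
      ((p.measurable_S_info (Nat.lt_succ_self _)).add (E.measurable_C_info (Nat.lt_succ_self _)))
  have hC := ae_all_iff.2 fun i => E.ae_integral_mul_C_rpow t hg (1 - U.θ) i
  filter_upwards [E.ae_law_eq t hm, E.ae_integral_one_add_slope U t, E.ae_integral_slope U t, hC]
    with ω h1 h2 h3 h4
  rw [Economy.utility]
  simp only [tradeSlope, if_true]
  congr 1
  · rw [← h2]
    refine integral_congr_ae ?_
    filter_upwards [E.ae_jointLaw_of_law h1] with z hz
    rw [hz]
  · set I := ∫ ω', p.gain t u v ω' / p.W (t + 1) ω' * E.C (t + 1) ω' ^ (1 - U.θ) ∂(E.law t ω)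
    set M := ∫ x, x ^ (1 - U.θ) ∂E.ν with hM
    have hterm : ∀ i : ℕ, (∫ z, U.γ * U.β ^ (i + 1) *
        (p.gain t u v z.1 / p.W (t + 1) z.1 * E.C (t + i + 1) z.1 ^ (1 - U.θ)
          * U.slope (E.C t z.2) (E.C t z.1)) ∂(E.jointLaw t ω))
        = U.γ * G E U (E.ε t ω) * U.β * I * (U.β * M) ^ i := by
      intro i
      rw [integral_const_mul, h3 fun ω' => p.gain t u v ω' / p.W (t + 1) ω'
        * E.C (t + i + 1) ω' ^ (1 - U.θ), h4 i, mul_pow]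
      ring
    change ∑' i : ℕ, (∫ z, U.γ * U.β ^ (i + 1) *
        (p.gain t u v z.1 / p.W (t + 1) z.1 * E.C (t + i + 1) z.1 ^ (1 - U.θ)
          * U.slope (E.C t z.2) (E.C t z.1)) ∂(E.jointLaw t ω)) = _
    simp_rw [hterm]
    -- With `M` the growth moment, the sum of `β ^ (i + 1) * M ^ i` is `β / (1 - β M) = β / κ`.
    rw [tsum_mul_left, tsum_geometric_of_lt_one
      (mul_nonneg U.β_pos.le (E.integral_rpow_nonneg _)) hgrowth, κ, ← hM]
    ring

/-- The expected marginal utility of a trade in closed form. -/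
theorem NotProfitable.ae_le (hgrowth : U.β * ∫ x, x ^ (1 - U.θ) ∂E.ν < 1)
    (hu : Measurable[E.info t] u) (hv : Measurable[E.info t] v) (h : p.NotProfitable U t u v) :
    ∀ᵐ ω ∂P, Integrable (fun ω' => E.C (t + 1) ω' ^ (-U.θ) * p.gain t u v ω'
        * A E U (E.ε (t + 1) ω')) (E.law t ω) ∧
      E.C t ω ^ (-U.θ) * u ω * A E U (E.ε t ω)
        + U.γ * G E U (E.ε t ω) * (U.β / κ E U)
          * ∫ ω', p.gain t u v ω' / p.W (t + 1) ω' * E.C (t + 1) ω' ^ (1 - U.θ) ∂(E.law t ω)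
        + U.β * ∫ ω', E.C (t + 1) ω' ^ (-U.θ) * p.gain t u v ω'
          * A E U (E.ε (t + 1) ω') ∂(E.law t ω) ≤ 0 := by
  filter_upwards [h, p.ae_utility_tradeSlope_self U hgrowth hu hv, E.ae_utility_eq t,
    E.ae_ae_law t (p.ae_utility_tradeSlope_succ U hu hv)] with ω h1 h2 h3 h4
  refine ⟨(h1.1 1).congr h4, ?_⟩
  have h5 := h1.2
  -- Only dates `t` and `t + 1` contribute; the utility at `t` is known at `t`, so its expectation
  -- is itself.
  rw [tsum_eq_sum (s := Finset.range 2) fun n hn => ?_, Finset.sum_range_succ,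
    Finset.sum_range_one] at h5
  · rw [pow_zero, one_mul, pow_one, integral_congr_ae h4, add_zero] at h5
    rw [← h2]
    rw [integral_congr_ae (h3.mono fun ω' h => h (p.tradeSlope U t u v))] at h5
    simpa using h5
  · obtain ⟨m, rfl⟩ : ∃ m, n = m + 2 :=
      ⟨n - 2, by have := Finset.mem_range.not.1 hn; omega⟩
    simp [utility_tradeSlope_of_lt]

/-- Stochastic part of marginal utility at date `t + 1`, as a function of the state, due to
contemporaneous consumption utility. -/
def kernelNow (E : Economy P) (U : Preferences) (z : ℝ × ℝ) : ℝ := z.1 ^ (-U.θ) * A E U z.1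

/-- Stochastic part of marginal utility at date `t + 1`, as a function of the state, due to
prospective gain-loss utility at date `t`. -/
def kernelAhead (z : ℝ × ℝ) : ℝ := z.1 ^ (-U.θ) * (z.2 / (z.2 + p.g z))

/-- The stock return as a function of the states at two consecutive dates. -/
def stockReturn (x z : ℝ × ℝ) : ℝ := z.1 * (x.2 / z.2) * ((p.g z + 1) / p.g x)

theorem RS_eq (t : ℕ) (ω : Ω) :
    p.RS t ω = p.stockReturn (E.ε t ω, E.Y t ω) (E.ε (t + 1) ω, E.Y (t + 1) ω) := by
  have h1 := (p.g_state_pos t ω).ne'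
  have h2 := (E.Y_pos t ω).ne'
  have h3 := (E.Y_pos (t + 1) ω).ne'
  have h4 := (E.C_pos t ω).ne'
  simp only [RS, S, Economy.D, E.C_succ t ω, stockReturn]
  field_simp

theorem measurable_kernelNow : Measurable (kernelNow E U) :=
  (measurable_fst.pow_const _).mul ((measurable_A E U).comp measurable_fst)

theorem measurable_kernelAhead : Measurable (p.kernelAhead U) :=
  (measurable_fst.pow_const _).mul (measurable_snd.div (measurable_snd.add p.measurable_g))

theorem measurable_stockReturn (x : ℝ × ℝ) : Measurable (p.stockReturn x) :=
  (measurable_fst.mul (measurable_const.div measurable_snd)).mul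
    ((p.measurable_g.add_const _).div_const _)

theorem C_rpow_mul_A (t : ℕ) (ω : Ω) :
    E.C (t + 1) ω ^ (-U.θ) * A E U (E.ε (t + 1) ω)
      = E.C t ω ^ (-U.θ) * kernelNow E U (E.ε (t + 1) ω, E.Y (t + 1) ω) := by
  rw [E.C_succ, Real.mul_rpow (E.C_pos _ _).le (E.ε_pos _ _).le, kernelNow, mul_assoc]

/-- Since `S = g * C / Y`, the consumption-wealth ratio is `Y / (Y + g)`, a function of the state
alone. -/
theorem C_rpow_div_W (t : ℕ) (ω : Ω) :
    E.C (t + 1) ω ^ (1 - U.θ) / p.W (t + 1) ω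
      = E.C t ω ^ (-U.θ) * p.kernelAhead U (E.ε (t + 1) ω, E.Y (t + 1) ω) := by
  have h3 := (E.Y_pos (t + 1) ω)
  have h4 := (E.C_pos (t + 1) ω)
  have h1 := p.g_state_pos (t + 1) ω
  have e : E.C (t + 1) ω / p.W (t + 1) ω
      = E.Y (t + 1) ω / (E.Y (t + 1) ω + p.g (E.ε (t + 1) ω, E.Y (t + 1) ω)) := by
    simp only [W, S, Economy.D]
    rw [div_eq_div_iff (by positivity) (by positivity)]
    field_simp
    ring
  rw [kernelAhead, ← e, ← mul_assoc, ← Real.mul_rpow (E.C_pos _ _).le (E.ε_pos _ _).le,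
    ← E.C_succ, sub_eq_add_neg, Real.rpow_add h4, Real.rpow_one]
  ring

/-- A trade whose gain is proportional to an excess payoff `X` that depends on the state at date
`t + 1`: its marginal utility in terms of the transition law. -/
theorem NotProfitable.ae_le_of_gain (hgrowth : U.β * ∫ x, x ^ (1 - U.θ) ∂E.ν < 1)
    (hu : Measurable[E.info t] u) (hv : Measurable[E.info t] v) (h : p.NotProfitable U t u v)
    {c : Ω → ℝ} (hc : ∀ ω, c ω ≠ 0) {X : Ω → ℝ × ℝ → ℝ} (hX : ∀ ω, Measurable (X ω))
    (hgain : ∀ᵐ ω ∂P, ∀ᵐ ω' ∂(E.law t ω),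
      p.gain t u v ω' = c ω * X ω (E.ε (t + 1) ω', E.Y (t + 1) ω')) :
    ∀ᵐ ω ∂P, Integrable (fun z => kernelNow E U z * X ω z) (E.Q (E.ε t ω, E.Y t ω)) ∧
      u ω * A E U (E.ε t ω) + c ω * (U.γ * G E U (E.ε t ω) * (U.β / κ E U)
          * ∫ z, p.kernelAhead U z * X ω z ∂(E.Q (E.ε t ω, E.Y t ω))
        + U.β * ∫ z, kernelNow E U z * X ω z ∂(E.Q (E.ε t ω, E.Y t ω))) ≤ 0 := by
  filter_upwards [NotProfitable.ae_le p U hgrowth hu hv h, hgain, E.ae_law_map_state t,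
    E.ae_law_eq t (E.measurable_C_info (Nat.lt_succ_self t))] with ω h1 h2 h3 h4
  have hst : Measurable fun ω' => (E.ε (t + 1) ω', E.Y (t + 1) ω') :=
    (E.measurable_ε _).prodMk (E.measurable_Y _)
  have hm1 : Measurable fun z => kernelNow E U z * X ω z := (measurable_kernelNow U).mul (hX ω)
  have hm2 : Measurable fun z => p.kernelAhead U z * X ω z :=
    (p.measurable_kernelAhead U).mul (hX ω)
  have hpos : 0 < E.C t ω ^ (-U.θ) := Real.rpow_pos_of_pos (E.C_pos t ω) _
  have e1 : (fun ω' => E.C (t + 1) ω' ^ (-U.θ) * p.gain t u v ω' * A E U (E.ε (t + 1) ω'))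
      =ᵐ[E.law t ω] fun ω' => (E.C t ω ^ (-U.θ) * c ω)
        * (kernelNow E U (E.ε (t + 1) ω', E.Y (t + 1) ω')
          * X ω (E.ε (t + 1) ω', E.Y (t + 1) ω')) := by
    filter_upwards [h2, h4] with ω' h2 h4
    rw [h2, mul_right_comm, C_rpow_mul_A, h4]
    ring
  have e2 : (fun ω' => p.gain t u v ω' / p.W (t + 1) ω' * E.C (t + 1) ω' ^ (1 - U.θ))
      =ᵐ[E.law t ω] fun ω' => (E.C t ω ^ (-U.θ) * c ω)
        * (p.kernelAhead U (E.ε (t + 1) ω', E.Y (t + 1) ω')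
          * X ω (E.ε (t + 1) ω', E.Y (t + 1) ω')) := by
    filter_upwards [h2, h4] with ω' h2 h4
    rw [h2, div_mul_eq_mul_div, mul_div_assoc, C_rpow_div_W, h4]
    ring
  obtain ⟨hi, hle⟩ := h1
  rw [integrable_congr e1] at hi
  rw [integral_congr_ae e1, integral_congr_ae e2, integral_const_mul, integral_const_mul] at hle
  have hi' : Integrable (fun ω' => kernelNow E U (E.ε (t + 1) ω', E.Y (t + 1) ω')
      * X ω (E.ε (t + 1) ω', E.Y (t + 1) ω')) (E.law t ω) := by
    refine (hi.const_mul (E.C t ω ^ (-U.θ) * c ω)⁻¹).congr (ae_of_all _ fun ω' => ?_)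
    exact inv_mul_cancel_left₀ (mul_ne_zero hpos.ne' (hc ω)) _
  rw [← h3, integral_map hst.aemeasurable hm1.aestronglyMeasurable,
    integral_map hst.aemeasurable hm2.aestronglyMeasurable,
    integrable_map_measure hm1.aestronglyMeasurable hst.aemeasurable]
  refine ⟨hi', ?_⟩
  -- The positive factor `C t ω ^ (-θ)`, known at date `t`, is common to all terms and drops out.
  refine nonpos_of_mul_nonpos_right (a := E.C t ω ^ (-U.θ)) (le_of_eq_of_le ?_ hle) hpos
  ring

/-- The Euler equations for the stock and for the risk-free asset. -/
theorem ae_euler (hgrowth : U.β * ∫ x, x ^ (1 - U.θ) ∂E.ν < 1) (hp : p.IsEquilibrium U) (t : ℕ) :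
    ∀ᵐ ω ∂P,
      Integrable (fun z => kernelNow E U z * p.stockReturn (E.ε t ω, E.Y t ω) z)
        (E.Q (E.ε t ω, E.Y t ω)) ∧
      Integrable (fun z => kernelNow E U z * (p.stockReturn (E.ε t ω, E.Y t ω) z - p.Rf t ω))
        (E.Q (E.ε t ω, E.Y t ω)) ∧
      A E U (E.ε t ω) = U.γ * G E U (E.ε t ω) * (U.β / κ E U)
          * ∫ z, p.kernelAhead U z * p.stockReturn (E.ε t ω, E.Y t ω) z
              ∂(E.Q (E.ε t ω, E.Y t ω))
        + U.β * ∫ z, kernelNow E U z * p.stockReturn (E.ε t ω, E.Y t ω) z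
              ∂(E.Q (E.ε t ω, E.Y t ω)) ∧
      0 = U.γ * G E U (E.ε t ω) * (U.β / κ E U)
          * ∫ z, p.kernelAhead U z * (p.stockReturn (E.ε t ω, E.Y t ω) z - p.Rf t ω)
              ∂(E.Q (E.ε t ω, E.Y t ω))
        + U.β * ∫ z, kernelNow E U z * (p.stockReturn (E.ε t ω, E.Y t ω) z - p.Rf t ω)
              ∂(E.Q (E.ε t ω, E.Y t ω)) := by
  obtain ⟨η, hη, hpos, hnp⟩ := p.exists_notProfitable U hp t
  have hS : Measurable[E.info t] (p.S t) := p.measurable_S_info (Nat.lt_succ_self t)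
  have hstate : Measurable[E.info t] fun ω => (E.ε t ω, E.Y t ω) :=
    E.measurable_state (Nat.lt_succ_self t)
  have hcons : ∀ k : ℝ, k ≠ 0 → |k| ≤ 1 → _ := fun k hk0 hk =>
    NotProfitable.ae_le_of_gain p U hgrowth (hη.const_mul k) measurable_const (hnp k hk).1
      (c := fun ω => -(k * η ω)) (fun ω => neg_ne_zero.2 (mul_ne_zero hk0 (hpos ω).ne'))
      (X := fun ω => p.stockReturn (E.ε t ω, E.Y t ω)) (fun ω => p.measurable_stockReturn _) (by
        filter_upwards [E.ae_law_eq t hη, E.ae_law_eq t hstate] with ω h1 h2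
        filter_upwards [h1, h2] with ω' h1 h2
        simp only [gain, h1, RS_eq, h2, zero_mul, add_zero])
  have hport : ∀ k : ℝ, k ≠ 0 → |k| ≤ 1 → _ := fun k hk0 hk =>
    NotProfitable.ae_le_of_gain p U hgrowth measurable_const (hη.const_mul k) (hnp k hk).2
      (c := fun ω => k * η ω * p.S t ω)
      (fun ω => mul_ne_zero (mul_ne_zero hk0 (hpos ω).ne') (p.S_pos t ω).ne')
      (X := fun ω z => p.stockReturn (E.ε t ω, E.Y t ω) z - p.Rf t ω)
      (fun ω => (p.measurable_stockReturn _).sub_const _) (by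
        filter_upwards [E.ae_law_eq t hη, E.ae_law_eq t hstate, E.ae_law_eq t hS,
          E.ae_law_eq t (p.adapted_Rf t)] with ω h1 h2 h3 h4
        filter_upwards [h1, h2, h3, h4] with ω' h1 h2 h3 h4
        simp only [gain, h1, RS_eq, h2, h3, h4, neg_zero, zero_mul, zero_add])
  -- The trades `k = 1` and `k = -1` give opposite inequalities, hence equations after division by
  -- the trade size.
  filter_upwards [hcons 1 (by simp) (by simp), hcons (-1) (by simp) (by simp),
    hport 1 (by simp) (by simp), hport (-1) (by simp) (by simp)] with ω h1 h2 h3 h4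
  refine ⟨h1.1, h3.1, ?_, ?_⟩
  · have a := h1.2
    have b := h2.2
    refine mul_left_cancel₀ (hpos ω).ne' (le_antisymm ?_ ?_) <;> linarith
  · have a := h3.2
    have b := h4.2
    have hη' : 0 < η ω * p.S t ω := mul_pos (hpos ω) (p.S_pos t ω)
    refine mul_left_cancel₀ hη'.ne' (le_antisymm ?_ ?_) <;> linarith

end Prices

/-! ### Solving the Euler equations. -/

namespace Prices

variable {E : Economy P} (p : Prices E) (U : Preferences)

theorem kernelAhead_bounds {z : ℝ × ℝ} (h1 : 0 < z.1) (h2 : 0 < z.2) :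
    0 ≤ p.kernelAhead U z ∧ p.kernelAhead U z ≤ kernelNow E U z := by
  have hg : 0 < p.g z := p.g_pos z.1 z.2 h1 h2
  have hr := Real.rpow_pos_of_pos h1 (-U.θ)
  refine ⟨by unfold kernelAhead; positivity, ?_⟩
  unfold kernelAhead kernelNow
  refine mul_le_mul_of_nonneg_left (le_trans ?_ (one_le_A E U z.1)) hr.le
  rw [div_le_one (by positivity)]
  linarith

/-- Domination: `kernelAhead` lies between 0 and `kernelNow`, because `Y / (Y + g) ≤ 1 ≤ A`. -/
theorem integrable_kernelAhead_mul {Q : Measure (ℝ × ℝ)} (hQ : ∀ᵐ z ∂Q, 0 < z.1 ∧ 0 < z.2)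
    {X : ℝ × ℝ → ℝ} (hX : Measurable X) (h : Integrable (fun z => kernelNow E U z * X z) Q) :
    Integrable (fun z => p.kernelAhead U z * X z) Q := by
  refine h.mono ((p.measurable_kernelAhead U).mul hX).aestronglyMeasurable ?_
  filter_upwards [hQ] with z hz
  obtain ⟨h0, hle⟩ := p.kernelAhead_bounds U hz.1 hz.2
  rw [norm_mul, norm_mul, Real.norm_of_nonneg h0, Real.norm_of_nonneg (h0.trans hle)]
  exact mul_le_mul_of_nonneg_right hle (norm_nonneg _)

/-- The Euler equations determine the risk-free return. -/
theorem riskFree_of_euler {Q : Measure (ℝ × ℝ)} (hQ : ∀ᵐ z ∂Q, 0 < z.1 ∧ 0 < z.2)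
    {r : ℝ × ℝ → ℝ} (hr : Measurable r) {a k b R : ℝ} (ha : 0 < a)
    (h1 : Integrable (fun z => kernelNow E U z * r z) Q)
    (h2 : Integrable (fun z => kernelNow E U z * (r z - R)) Q)
    (h3 : a = k * ∫ z, p.kernelAhead U z * r z ∂Q + b * ∫ z, kernelNow E U z * r z ∂Q)
    (h4 : 0 = k * ∫ z, p.kernelAhead U z * (r z - R) ∂Q
      + b * ∫ z, kernelNow E U z * (r z - R) ∂Q) :
    Integrable (kernelNow E U) Q ∧ Integrable (p.kernelAhead U) Q ∧
      R = a * (k * ∫ z, p.kernelAhead U z ∂Q + b * ∫ z, kernelNow E U z ∂Q)⁻¹ := by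
  -- For `R = 0` the two Euler equations would have the same right-hand side, forcing `a = 0`.
  have hR : R ≠ 0 := by
    rintro rfl
    simp only [sub_zero] at h4
    linarith
  -- Only the payoffs `r` and `r - R` are known to be integrable against the kernel; their
  -- difference is the constant `R`, which may be divided out.
  have hn : Integrable (kernelNow E U) Q := by
    refine ((h1.sub h2).div_const R).congr (ae_of_all _ fun z => ?_)
    simp only [Pi.sub_apply]
    field_simp
    ring
  have hh : Integrable (p.kernelAhead U) Q := by
    simpa using p.integrable_kernelAhead_mul U hQ (X := fun _ => 1) measurable_const
      (by simpa using hn)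
  have hhr := p.integrable_kernelAhead_mul U hQ hr h1
  refine ⟨hn, hh, ?_⟩
  simp only [mul_sub] at h4
  rw [integral_sub hhr (hh.mul_const R), integral_sub h1 (hn.mul_const R), integral_mul_const,
    integral_mul_const] at h4
  have h5 : a = R * (k * ∫ z, p.kernelAhead U z ∂Q + b * ∫ z, kernelNow E U z ∂Q) := by
    linarith
  have h6 : k * ∫ z, p.kernelAhead U z ∂Q + b * ∫ z, kernelNow E U z ∂Q ≠ 0 := by
    intro h0
    rw [h0] at h5
    linarith
  rw [eq_mul_inv_iff_mul_eq₀ h6, h5]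

/-- The function `h` of the pricing formulas. -/
def scaledRatio (z : ℝ × ℝ) : ℝ := p.g z * A E U z.1 * κ E U

/-- With `h = g A κ` the denominator is `(Y + g) A κ`, so `A` cancels and a factor `1 / κ` remains.
-/
theorem scaledRatio_ahead (hκ : 0 < κ E U) {z : ℝ × ℝ} (h1 : 0 < z.1) (h2 : 0 < z.2) :
    z.1 ^ (-U.θ) * z.2 * (A E U z.1 / (z.2 * A E U z.1 * κ E U + p.scaledRatio U z))
      = p.kernelAhead U z / κ E U := by
  have hg : 0 < p.g z := p.g_pos z.1 z.2 h1 h2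
  have hA := A_pos E U z.1
  have e : z.2 * A E U z.1 * κ E U + p.scaledRatio U z
      = (z.2 + p.g z) * A E U z.1 * κ E U := by
    unfold scaledRatio; ring
  rw [e, kernelAhead]
  field_simp

theorem scaledRatio_ahead_mul (hκ : 0 < κ E U) {x z : ℝ × ℝ} (hx : 0 < p.g x) (h1 : 0 < z.1)
    (h2 : 0 < z.2) :
    z.1 ^ (1 - U.θ) * x.2 * ((A E U z.1 * κ E U + p.scaledRatio U z)
        / (z.2 * A E U z.1 * κ E U + p.scaledRatio U z))
      = p.g x * (p.kernelAhead U z * p.stockReturn x z) := by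
  have hg : 0 < p.g z := p.g_pos z.1 z.2 h1 h2
  have hA := A_pos E U z.1
  have e : z.2 * A E U z.1 * κ E U + p.scaledRatio U z
      = (z.2 + p.g z) * (A E U z.1 * κ E U) := by
    unfold scaledRatio; ring
  have e' : A E U z.1 * κ E U + p.scaledRatio U z = (p.g z + 1) * (A E U z.1 * κ E U) := by
    unfold scaledRatio; ring
  rw [e, e', mul_div_mul_right _ _ (mul_pos hA hκ).ne', kernelAhead, stockReturn, sub_eq_add_neg,
    Real.rpow_add h1, Real.rpow_one]
  field_simp

theorem scaledRatio_now_mul {x z : ℝ × ℝ} (hx : 0 < p.g x) (h1 : 0 < z.1) :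
    z.1 ^ (1 - U.θ) * (x.2 / z.2) * (p.scaledRatio U z + A E U z.1 * κ E U)
      = p.g x * κ E U * (kernelNow E U z * p.stockReturn x z) := by
  rw [scaledRatio, kernelNow, stockReturn, sub_eq_add_neg, Real.rpow_add h1, Real.rpow_one]
  field_simp

end Prices

end Model

end GainLoss

end

/-! ### The pricing formulas from the Euler equations. -/

theorem theorem1 {Ω : Type*} [MeasurableSpace Ω] [StandardBorelSpace Ω]
    (P : Measure Ω) [IsProbabilityMeasure P] (E : Economy P) (U : Preferences)
    (hint : Integrable (fun x : ℝ => x ^ (1 - U.θ)) E.ν)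
    (hgrowth : U.β * ∫ x, x ^ (1 - U.θ) ∂E.ν < 1)
    (p : Prices E) (hp : p.IsEquilibrium U) :
    ∃ h : ℝ × ℝ → ℝ, Measurable h ∧ (∀ e y, 0 < e → 0 < y → 0 < h (e, y)) ∧
      -- the expectations in the formulas below are finite
      Integrable (fun x : ℝ => x ^ (-U.θ) * A E U x) E.ν ∧
      (∀ t, ∀ᵐ ω ∂P,
        Integrable (fun z : ℝ × ℝ => z.1 ^ (-U.θ) * z.2 *
          (A E U z.1 / (z.2 * A E U z.1 * κ E U + h z))) (E.Q (E.ε t ω, E.Y t ω)) ∧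
        Integrable (fun z : ℝ × ℝ => z.1 ^ (1 - U.θ) * E.Y t ω *
          ((A E U z.1 * κ E U + h z) / (z.2 * A E U z.1 * κ E U + h z)))
          (E.Q (E.ε t ω, E.Y t ω)) ∧
        Integrable (fun z : ℝ × ℝ => z.1 ^ (1 - U.θ) * (E.Y t ω / z.2) *
          (h z + A E U z.1 * κ E U)) (E.Q (E.ε t ω, E.Y t ω))) ∧
      -- risk-free return
      (∀ t, ∀ᵐ ω ∂P,
        p.Rf t ω = A E U (E.ε t ω) *
          (U.γ * G E U (E.ε t ω) *
              (U.β * ∫ z, z.1 ^ (-U.θ) * z.2 *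
                (A E U z.1 / (z.2 * A E U z.1 * κ E U + h z)) ∂(E.Q (E.ε t ω, E.Y t ω)))
            + U.β * ∫ x, x ^ (-U.θ) * A E U x ∂E.ν)⁻¹) ∧
      -- price-dividend ratio
      (∀ t, ∀ᵐ ω ∂P,
        p.S t ω / E.D t ω = h (E.ε t ω, E.Y t ω) / (A E U (E.ε t ω) * κ E U)) ∧
      -- integral equation for `h`
      (∀ t, ∀ᵐ ω ∂P,
        h (E.ε t ω, E.Y t ω) =
          U.γ * G E U (E.ε t ω) *
              (U.β * ∫ z, z.1 ^ (1 - U.θ) * E.Y t ω *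
                ((A E U z.1 * κ E U + h z) / (z.2 * A E U z.1 * κ E U + h z))
                ∂(E.Q (E.ε t ω, E.Y t ω)))
            + U.β * ∫ z, z.1 ^ (1 - U.θ) * (E.Y t ω / z.2) * (h z + A E U z.1 * κ E U)
                ∂(E.Q (E.ε t ω, E.Y t ω))) ∧
      -- stock return
      (∀ t, ∀ᵐ ω ∂P,
        p.RS t ω = E.ε (t + 1) ω * (E.Y t ω / E.Y (t + 1) ω) *
          (A E U (E.ε t ω) / h (E.ε t ω, E.Y t ω)) *
          (h (E.ε (t + 1) ω, E.Y (t + 1) ω) / A E U (E.ε (t + 1) ω) + κ E U)) := by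
  have hκ : 0 < κ E U := by unfold κ; linarith
  have hstate : ∀ t, ∀ᵐ ω ∂P, ∀ᵐ z ∂(E.Q (E.ε t ω, E.Y t ω)), 0 < z.1 ∧ 0 < z.2 := by
    intro t
    filter_upwards [E.ae_law_map_state t] with ω hω
    have hpos : MeasurableSet {z : ℝ × ℝ | 0 < z.1 ∧ 0 < z.2} :=
      (measurableSet_lt measurable_const measurable_fst).inter
        (measurableSet_lt measurable_const measurable_snd)
    rw [← hω, ae_map_iff ((E.measurable_ε _).prodMk (E.measurable_Y _)).aemeasurable hpos]
    exact ae_of_all _ fun ω' => ⟨E.ε_pos _ ω', E.Y_pos _ ω'⟩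
  have hnow : Measurable fun x : ℝ => x ^ (-U.θ) * A E U x :=
    (measurable_id.pow_const _).mul (measurable_A E U)
  have hν : ∀ x, E.ν = (E.Q x).map Prod.fst := fun x => (E.Q_fst x).symm
  have hmain : ∀ t, ∀ᵐ ω ∂P, _ := fun t => by
    filter_upwards [p.ae_euler U hgrowth hp t, hstate t] with ω h1 h2
    exact And.intro h1 (p.riskFree_of_euler U h2 (p.measurable_stockReturn _) (A_pos E U _)
      h1.1 h1.2.1 h1.2.2.1 h1.2.2.2)
  refine ⟨p.scaledRatio U, (p.measurable_g.mul ((measurable_A E U).comp measurable_fst)).mul_const _,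
    fun e y he hy => mul_pos (mul_pos (p.g_pos e y he hy) (A_pos E U e)) hκ, ?_, ?_, ?_, ?_, ?_, ?_⟩
  · obtain ⟨ω, hω⟩ := (hmain 0).exists
    rw [hν (E.ε 0 ω, E.Y 0 ω), integrable_map_measure hnow.aestronglyMeasurable
      measurable_fst.aemeasurable]
    exact hω.2.1
  · intro t
    filter_upwards [hmain t, hstate t] with ω h1 h2
    have hg := p.g_state_pos t ω
    refine ⟨(h1.2.2.1.div_const (κ E U)).congr ?_,
      ((p.integrable_kernelAhead_mul U h2 (p.measurable_stockReturn _) h1.1.1).const_mul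
        (p.g (E.ε t ω, E.Y t ω))).congr ?_,
      (h1.1.1.const_mul (p.g (E.ε t ω, E.Y t ω) * κ E U)).congr ?_⟩
    · exact h2.mono fun z hz => (p.scaledRatio_ahead U hκ hz.1 hz.2).symm
    · exact h2.mono fun z hz => (p.scaledRatio_ahead_mul U hκ hg hz.1 hz.2).symm
    · exact h2.mono fun z hz => (p.scaledRatio_now_mul U hg hz.1).symm
  · intro t
    filter_upwards [hmain t, hstate t] with ω h1 h2
    rw [integral_congr_ae (h2.mono fun z hz => p.scaledRatio_ahead U hκ hz.1 hz.2), integral_div,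
      hν (E.ε t ω, E.Y t ω),
      integral_map measurable_fst.aemeasurable hnow.aestronglyMeasurable]
    refine h1.2.2.2.trans ?_
    simp only [Prices.kernelNow]
    congr 3
    ring
  · refine fun t => ae_of_all _ fun ω => ?_
    have hA := A_pos E U (E.ε t ω)
    have hD := E.D_pos t ω
    rw [Prices.S, Prices.scaledRatio]
    field_simp
  · intro t
    filter_upwards [hmain t, hstate t] with ω h1 h2
    have hg := p.g_state_pos t ω
    rw [integral_congr_ae (h2.mono fun z hz => p.scaledRatio_ahead_mul U hκ hg hz.1 hz.2),
      integral_congr_ae (h2.mono fun z hz => p.scaledRatio_now_mul U hg hz.1),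
      integral_const_mul, integral_const_mul, Prices.scaledRatio]
    -- The left side is `g A κ`; the stock Euler equation replaces `A` and yields the integral
    -- equation.
    nth_rewrite 1 [h1.1.2.2.1]
    field_simp
  · refine fun t => ae_of_all _ fun ω => ?_
    have hA := A_pos E U (E.ε t ω)
    have hA' := A_pos E U (E.ε (t + 1) ω)
    have hg := p.g_state_pos t ω
    rw [p.RS_eq, Prices.scaledRatio, Prices.scaledRatio, Prices.stockReturn]
    field_simp
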